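/- Let $p>2$ be a prime, let $L$ be a finite extension of $\mathbb{Q}_p$ with ring of integers $A$ and residue field $k_L$, and let $K:=\mathrm{GL}_2(\mathbb{Z}_p)$. Let $\theta_1,\theta_2:\mathbb{Z}_p^\times\to L^\times$ be smooth characters (i.e. with open kernel; they automatically take values in $A^\times$), let $\bar\theta_1,\bar\theta_2:\mathbb{Z}_p^\times\to k_L^\times$ be their reductions, and let $\omega:\mathbb{Z}_p^\times\to k_L^\times$ be the natural reduction map. Define a representation $\tau(\theta_1,\theta_2)$ of $K$ over $L$ as follows. If $\theta_1=\theta_2$, put $\tau(\theta_1,\theta_2):=\theta_1\circ\det$. If $\theta_1\neq\theta_2$, let $c\ge 1$ be the smallest integer such that $\theta_1\theta_2^{-1}$ is trivial on $1+p^c\mathbb{Z}_p$, let $J_c\subset K$ be the subgroup of matrices $\begin{pmatrix} a& b\\ c'& d\end{pmatrix}$ with $c'\in p^c\mathbb{Z}_p$, and put $\tau(\theta_1,\theta_2):=\mathrm{Ind}_{J_c}^K(\theta_1\otimes\theta_2)$, where $\theta_1\otimes\theta_2$ is the character $\begin{pmatrix} a& b\\ c'& d\end{pmatrix}\mapsto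 (\theta_1\theta_2^{-1})(a)\,\theta_2(ad-bc')$ of $J_c$ (which equals $\theta_1(a)\theta_2(d)$ whenever $\theta_1$ and $\theta_2$ are trivial on $1+p^c\mathbb{Z}_p$). Let $k\ge 2$ be an integer and let $M$ be a $K$-stable lattice in $\tau(\theta_1,\theta_2)\otimes_L\mathrm{Sym}^{k-2}L^2$, i.e. a $K$-stable finitely generated $A$-submodule that spans this $L$-vector space. Assume: (a) if $\theta_1=\theta_2$, then $k\ge p^2+1$; (b) if $\theta_1\ne\theta_2$ and $\theta_1\theta_2^{-1}$ is trivial on $1+p\mathbb{Z}_p$, then $k\ge p$. (If $\theta_1\theta_2^{-1}$ is non-trivial on $1+p\mathbb{Z}_p$, there is no condition beyond $k\ge 2$.) Then every irreducible smooth $k_L$-representation $\sigma$ of $K$ with central character $\bar\theta_1\bar\theta_2\omega^{k-2}$ (i.e. the scalar matrix $u\in\mathbb{Z}_p^\times$ acts on $\sigma$ by $\bar\theta_1(u)\bar\theta_2(u)\omega(u)^{k-2}$) is isomorphic to a subquotient of $M\otimes_A k_L$. -/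

import Mathlib

open scoped TensorProduct

noncomputable section

namespace PadicTypes

/-! ### The coefficient field: ring of integers and residue field -/

section Coefficients

variable (p : ℕ) [Fact p.Prime] (L : Type*) [Field L] [Algebra ℤ_[p] L]

/-- The ring of integers `A` of a finite extension `L` of `ℚ_p`: the integral closure of `ℤ_p`. -/
abbrev ringOfInt : Subalgebra ℤ_[p] L := integralClosure ℤ_[p] L

variable [Algebra ℚ_[p] L] [IsScalarTower ℤ_[p] ℚ_[p] L]

variable {p L} in
theorem mem_ringOfInt_iff [FiniteDimensional ℚ_[p] L] (x : L) :
    x ∈ ringOfInt p L ↔ spectralNorm ℚ_[p] L x ≤ 1 := by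
  have hx : IsIntegral ℚ_[p] x := Algebra.IsIntegral.isIntegral x
  rw [spectralNorm, spectralValue_le_one_iff (minpoly.monic hx)]
  change IsIntegral ℤ_[p] x ↔ _
  constructor
  · intro h n
    rw [minpoly.isIntegrallyClosed_eq_field_fractions' ℚ_[p] h, Polynomial.coeff_map]
    exact PadicInt.norm_le_one _
  · intro h
    have hl : minpoly ℚ_[p] x ∈ Polynomial.lifts (algebraMap ℤ_[p] ℚ_[p]) := by
      rw [Polynomial.lifts_iff_coeff_lifts]
      intro n
      exact ⟨⟨_, h n⟩, rfl⟩
    obtain ⟨q, hq, -, hm⟩ := Polynomial.lifts_and_natDegree_eq_and_monic hl (minpoly.monic hx)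
    refine ⟨q, hm, ?_⟩
    rw [← Polynomial.aeval_def, ← Polynomial.aeval_map_algebraMap ℚ_[p], hq, minpoly.aeval]

instance ringOfInt_isLocalRing [FiniteDimensional ℚ_[p] L] : IsLocalRing (ringOfInt p L) := by
  have hunit : ∀ a : ringOfInt p L, spectralNorm ℚ_[p] L (a : L) = 1 → IsUnit a := by
    intro a ha
    have ha0 : (a : L) ≠ 0 := by
      intro h
      rw [h, spectralNorm_zero] at ha
      exact zero_ne_one ha
    have hmul : spectralMulAlgNorm ℚ_[p] L ((a : L)⁻¹ * (a : L)) =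
        spectralMulAlgNorm ℚ_[p] L ((a : L)⁻¹) * spectralMulAlgNorm ℚ_[p] L (a : L) :=
      map_mul _ _ _
    rw [inv_mul_cancel₀ ha0, map_one, spectralMulAlgNorm_def, spectralMulAlgNorm_def, ha,
      mul_one] at hmul
    have hi : (a : L)⁻¹ ∈ ringOfInt p L := (mem_ringOfInt_iff _).2 hmul.symm.le
    refine IsUnit.of_mul_eq_one ⟨_, hi⟩ ?_
    ext
    exact mul_inv_cancel₀ ha0
  refine IsLocalRing.of_isUnit_or_isUnit_one_sub_self fun a => ?_
  have ha := (mem_ringOfInt_iff _).1 a.2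
  rcases ha.eq_or_lt with h | h
  · exact Or.inl (hunit a h)
  · refine Or.inr (hunit _ (le_antisymm ((mem_ringOfInt_iff _).1 (1 - a).2) ?_))
    by_contra! hlt
    have hna := isNonarchimedean_spectralNorm (K := ℚ_[p]) (L := L) (a : L) ((1 - a : ringOfInt p L) : L)
    have h1 : (a : L) + ((1 - a : ringOfInt p L) : L) = 1 := by push_cast; ring
    rw [h1, spectralNorm_one] at hna
    exact absurd hna (not_le.2 (max_lt h hlt))

/-- The residue field `k_L` of `L`. -/
abbrev resField [FiniteDimensional ℚ_[p] L] : Type _ := IsLocalRing.ResidueField (ringOfInt p L)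

end Coefficients

/-! ### Smooth characters of `ℤ_pˣ` and their reductions -/

section Characters

variable {p : ℕ} [Fact p.Prime] {L : Type*} [Field L]

/-- A character of `ℤ_pˣ` is smooth if its kernel is open. -/
def IsSmoothChar (θ : ℤ_[p]ˣ →* Lˣ) : Prop := IsOpen (θ.ker : Set ℤ_[p]ˣ)

/-- `θ` is trivial on `1 + p ^ c ℤ_p` (for `c = 0`: on all of `ℤ_pˣ`). -/
def TrivialOn (θ : ℤ_[p]ˣ →* Lˣ) (c : ℕ) : Prop :=
  ∀ u : ℤ_[p]ˣ, (p : ℤ_[p]) ^ c ∣ (u : ℤ_[p]) - 1 → θ u = 1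

theorem IsSmoothChar.exists_trivialOn {θ : ℤ_[p]ˣ →* Lˣ} (hθ : IsSmoothChar θ) :
    ∃ c : ℕ, 1 ≤ c ∧ TrivialOn θ c := by
  have hn : Units.val '' (θ.ker : Set ℤ_[p]ˣ) ∈ nhds (1 : ℤ_[p]) :=
    (Units.isOpenEmbedding_val.isOpenMap _ hθ).mem_nhds ⟨1, one_mem _, rfl⟩
  obtain ⟨ε, hε, hball⟩ := Metric.mem_nhds_iff.1 hn
  obtain ⟨c, hc⟩ := PadicInt.exists_pow_neg_lt p hε
  refine ⟨c + 1, by omega, fun u hu => ?_⟩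
  have hu' : (p : ℤ_[p]) ^ c ∣ (u : ℤ_[p]) - 1 := (pow_dvd_pow _ (Nat.le_succ c)).trans hu
  rw [← Ideal.mem_span_singleton, ← PadicInt.norm_le_pow_iff_mem_span_pow] at hu'
  obtain ⟨v, hv, hvu⟩ := hball (show (u : ℤ_[p]) ∈ Metric.ball 1 ε by
    rw [Metric.mem_ball, dist_eq_norm]; exact hu'.trans_lt hc)
  rw [← Units.ext hvu]
  exact hv

theorem IsSmoothChar.div {θ₁ θ₂ : ℤ_[p]ˣ →* Lˣ} (h₁ : IsSmoothChar θ₁) (h₂ : IsSmoothChar θ₂) :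
    IsSmoothChar (θ₁ / θ₂) := by
  refine Subgroup.isOpen_mono (H₁ := θ₁.ker ⊓ θ₂.ker) ?_ (IsOpen.inter h₁ h₂)
  rintro u ⟨hu₁, hu₂⟩
  have e₁ : θ₁ u = 1 := hu₁
  have e₂ : θ₂ u = 1 := hu₂
  rw [MonoidHom.mem_ker, MonoidHom.div_apply, e₁, e₂, div_one]

/-- A smooth character of the compact group `ℤ_pˣ` has finite order. -/
theorem IsSmoothChar.exists_pow_eq_one {θ : ℤ_[p]ˣ →* Lˣ} (hθ : IsSmoothChar θ) :
    ∃ n : ℕ, 0 < n ∧ ∀ u, θ u ^ n = 1 := by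
  obtain ⟨c, -, hc⟩ := hθ.exists_trivialOn
  have : NeZero (p ^ c) := ⟨pow_ne_zero _ (Fact.out : p.Prime).ne_zero⟩
  refine ⟨Fintype.card (ZMod (p ^ c))ˣ, Fintype.card_pos, fun u => ?_⟩
  rw [← map_pow]
  apply hc
  have h := pow_card_eq_one (x := Units.map (PadicInt.toZModPow c).toMonoidHom u)
  rw [← map_pow] at h
  rw [← Ideal.mem_span_singleton, ← PadicInt.ker_toZModPow, RingHom.mem_ker, map_sub, map_one,
    sub_eq_zero]
  exact congrArg Units.val h

variable [Algebra ℤ_[p] L]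

theorem IsSmoothChar.mem_ringOfInt {θ : ℤ_[p]ˣ →* Lˣ} (hθ : IsSmoothChar θ) (u : ℤ_[p]ˣ) :
    ((θ u : Lˣ) : L) ∈ ringOfInt p L := by
  obtain ⟨n, hn, h⟩ := hθ.exists_pow_eq_one
  refine IsIntegral.of_pow hn ?_
  rw [← Units.val_pow_eq_pow_val, h u, Units.val_one]
  exact isIntegral_one

/-- A smooth character, seen as a character with values in `A`. -/
def integralChar (θ : ℤ_[p]ˣ →* Lˣ) (hθ : IsSmoothChar θ) : ℤ_[p]ˣ →* ringOfInt p L where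
  toFun u := ⟨(θ u : L), hθ.mem_ringOfInt u⟩
  map_one' := by ext; simp
  map_mul' u v := by ext; simp

variable [Algebra ℚ_[p] L] [IsScalarTower ℤ_[p] ℚ_[p] L] [FiniteDimensional ℚ_[p] L]

/-- The reduction `θ̄ : ℤ_pˣ → k_Lˣ` of a smooth character `θ`. -/
def reductionChar (θ : ℤ_[p]ˣ →* Lˣ) (hθ : IsSmoothChar θ) : ℤ_[p]ˣ →* (resField p L)ˣ :=
  ((IsLocalRing.residue (ringOfInt p L)).toMonoidHom.comp (integralChar θ hθ)).toHomUnits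

variable (p L) in
/-- The character `ω : ℤ_pˣ → k_Lˣ`: reduction modulo the maximal ideal. -/
def omega : ℤ_[p]ˣ →* (resField p L)ˣ :=
  Units.map ((IsLocalRing.residue (ringOfInt p L)).comp
    (algebraMap ℤ_[p] (ringOfInt p L))).toMonoidHom

end Characters

/-! ### General constructions with representations -/

section General

variable {G : Type*} [Group G]

/-- The one-dimensional representation attached to a character. -/
def charRep {F : Type*} [Field F] (χ : G →* Fˣ) : Representation F G F where
  toFun g := (χ g : F) • LinearMap.id
  map_one' := by ext; simp
  map_mul' g h := by ext; simp [mul_comm]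

/-- `σ` is (isomorphic to) a subquotient `N / ker f` of `ρ`, for a subrepresentation `N` of `ρ`. -/
def IsSubquotient {F : Type*} [Field F] {V W : Type*} [AddCommGroup V] [Module F V]
    [AddCommGroup W] [Module F W] (σ : Representation F G W) (ρ : Representation F G V) : Prop :=
  ∃ (N : Subrepresentation ρ) (f : N.toRepresentation.IntertwiningMap σ), Function.Surjective f

/-- A representation of a topological group is smooth if all stabilizers are open. -/
def IsSmoothRep [TopologicalSpace G] {F : Type*} [Field F] {V : Type*} [AddCommGroup V]
    [Module F V] (σ : Representation F G V) : Prop :=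
  ∀ v : V, IsOpen {g : G | σ g v = v}

/-- An `A`-submodule `M` of a representation of `G` over `L` is `G`-stable. -/
def IsStable {A L : Type*} [CommRing A] [Field L] {V : Type*} [AddCommGroup V]
    [Module L V] [Module A V] (ρ : Representation L G V) (M : Submodule A V) : Prop :=
  ∀ (g : G), ∀ v ∈ M, ρ g v ∈ M

/-- The representation of `G` on a stable `A`-submodule. -/
def latticeRep {A L : Type*} [CommRing A] [Field L] [Algebra A L] {V : Type*} [AddCommGroup V]
    [Module L V] [Module A V] [IsScalarTower A L V] (ρ : Representation L G V)
    (M : Submodule A V) (hM : IsStable ρ M) : Representation A G M where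
  toFun g := ((ρ g).restrictScalars A).restrict (hM g)
  map_one' := by ext; simp
  map_mul' g h := by
    ext x
    exact LinearMap.congr_fun (map_mul ρ g h) (x : V)

/-- The representation `k ⊗_A M` obtained by extension of scalars. -/
def baseChangeRep {A : Type*} (k : Type*) [CommRing A] [Field k] [Algebra A k] {M : Type*}
    [AddCommGroup M] [Module A M] (ρ : Representation A G M) :
    Representation k G (k ⊗[A] M) where
  toFun g := (ρ g).baseChange k
  map_one' := by rw [map_one, LinearMap.baseChange_one]
  map_mul' g h := by rw [map_mul, LinearMap.baseChange_mul]

end General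

/-! ### Symmetric powers of the standard representation -/

section Sym

open MvPolynomial

variable (R : Type*) [CommRing R]

/-- The substitution `X_j ↦ ∑ i, g_{ij} X_i`, i.e. the action of `g` on the symmetric algebra
`R[X_0, X_1]` of `R²`, where `X_0, X_1` is the standard basis of `R²`. -/
def substGL (g : GL (Fin 2) R) : MvPolynomial (Fin 2) R →ₐ[R] MvPolynomial (Fin 2) R :=
  aeval fun j => ∑ i, C ((g : Matrix (Fin 2) (Fin 2) R) i j) * X i

theorem substGL_one : substGL R 1 = AlgHom.id R _ := by
  refine algHom_ext fun j => ?_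
  fin_cases j <;> simp [substGL]

theorem substGL_mul (g h : GL (Fin 2) R) :
    substGL R (g * h) = (substGL R g).comp (substGL R h) := by
  refine algHom_ext fun j => ?_
  simp [substGL, Matrix.mul_apply, algebraMap_eq]
  ring

theorem substGL_mem (n : ℕ) (g : GL (Fin 2) R) (P : MvPolynomial (Fin 2) R)
    (hP : P ∈ homogeneousSubmodule (Fin 2) R n) :
    substGL R g P ∈ homogeneousSubmodule (Fin 2) R n := by
  have h := (show P.IsHomogeneous n from hP).aeval
    (fun j => ∑ i, C ((g : Matrix (Fin 2) (Fin 2) R) i j) * X i) (n := 1)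
    (fun j => IsHomogeneous.sum _ _ _ fun i _ => by
      simpa using (isHomogeneous_C (Fin 2) _).mul (isHomogeneous_X R i))
  rw [one_mul] at h
  exact h

/-- `Sym^n R²`: homogeneous polynomials of degree `n` in the standard basis vectors. -/
abbrev SymPow (n : ℕ) : Submodule R (MvPolynomial (Fin 2) R) := homogeneousSubmodule (Fin 2) R n

/-- The natural action of `GL₂(R)` on `Sym^n R²`. -/
def symRep (n : ℕ) : Representation R (GL (Fin 2) R) (SymPow R n) where
  toFun g := (substGL R g).toLinearMap.restrict (substGL_mem R n g)
  map_one' := by ext x : 2; simp [substGL_one]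
  map_mul' g h := by
    ext x : 2
    exact AlgHom.congr_fun (substGL_mul R g h) (x : MvPolynomial (Fin 2) R)

/-- `Sym^n L²` as a representation of `K = GL₂(ℤ_p)`. -/
def symRepK (p : ℕ) [Fact p.Prime] (L : Type*) [Field L] [Algebra ℤ_[p] L] (n : ℕ) :
    Representation L (GL (Fin 2) ℤ_[p]) (SymPow L n) :=
  (symRep L n).comp (Matrix.GeneralLinearGroup.map (algebraMap ℤ_[p] L))

end Sym

/-! ### The representation `τ(θ₁, θ₂)` -/

section Tau

variable {p : ℕ} [Fact p.Prime]

variable (p) in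
/-- The subgroup `J_c` of matrices in `GL₂(ℤ_p)` with lower left entry in `p ^ c ℤ_p`. For `c ≥ 1`
the diagonal entries of its elements are automatically units. -/
def J (c : ℕ) : Subgroup (GL (Fin 2) ℤ_[p]) where
  carrier := {g | (p : ℤ_[p]) ^ c ∣ g.val 1 0}
  one_mem' := by simp
  mul_mem' {g h} hg hh := by
    simp only [Set.mem_ofPred_eq, Units.val_mul, Matrix.mul_apply, Fin.sum_univ_two] at *
    exact dvd_add (hg.mul_right _) (hh.mul_left _)
  inv_mem' {g} hg := by
    simp only [Set.mem_ofPred_eq, Matrix.coe_units_inv, Matrix.inv_def, Matrix.adjugate_fin_two,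
      Matrix.smul_apply, Matrix.of_apply, Matrix.cons_val', Matrix.cons_val_zero,
      Matrix.cons_val_one, smul_eq_mul] at *
    exact ((dvd_neg.2 hg)).mul_left _

theorem isUnit_apply_zero_zero {c : ℕ} (hc : 1 ≤ c) (g : J p c) : IsUnit (g.1.val 0 0) := by
  have hdet : IsUnit (g.1.val.det) := g.1.isUnit.map Matrix.detMonoidHom
  by_contra h
  have h00 : g.1.val 0 0 ∈ IsLocalRing.maximalIdeal ℤ_[p] := h
  have h10 : g.1.val 1 0 ∈ IsLocalRing.maximalIdeal ℤ_[p] := by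
    rw [PadicInt.maximalIdeal_eq_span_p, Ideal.mem_span_singleton]
    exact (dvd_pow_self _ (by omega)).trans g.2
  have : g.1.val.det ∈ IsLocalRing.maximalIdeal ℤ_[p] := by
    rw [Matrix.det_fin_two]
    exact Ideal.sub_mem _ (Ideal.mul_mem_right _ _ h00) (Ideal.mul_mem_left _ _ h10)
  exact this hdet

/-- The upper left entry of an element of `J_c`, `c ≥ 1`, as a unit. -/
def upperLeft {c : ℕ} (hc : 1 ≤ c) (g : J p c) : ℤ_[p]ˣ := (isUnit_apply_zero_zero hc g).unit

@[simp] theorem val_upperLeft {c : ℕ} (hc : 1 ≤ c) (g : J p c) :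
    (upperLeft hc g : ℤ_[p]) = g.1.val 0 0 := rfl

variable {L : Type*} [Field L]

theorem map_upperLeft_mul {c : ℕ} (hc : 1 ≤ c) {θ : ℤ_[p]ˣ →* Lˣ} (hθ : TrivialOn θ c)
    (g h : J p c) : θ (upperLeft hc (g * h)) = θ (upperLeft hc g) * θ (upperLeft hc h) := by
  have key : θ (upperLeft hc (g * h) * (upperLeft hc g * upperLeft hc h)⁻¹) = 1 := by
    apply hθ
    have hgh : (upperLeft hc (g * h) : ℤ_[p]) =
        (upperLeft hc g : ℤ_[p]) * upperLeft hc h + g.1.val 0 1 * h.1.val 1 0 := by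
      simp [Matrix.mul_apply, Fin.sum_univ_two]
    have : ((upperLeft hc (g * h) * (upperLeft hc g * upperLeft hc h)⁻¹ : ℤ_[p]ˣ) : ℤ_[p]) - 1 =
        g.1.val 0 1 * h.1.val 1 0 * ((upperLeft hc g * upperLeft hc h)⁻¹ : ℤ_[p]ˣ) := by
      rw [Units.val_mul, hgh, add_mul, ← Units.val_mul, ← Units.val_mul, mul_inv_cancel,
        Units.val_one]
      ring
    rw [this]
    exact (h.2.mul_left _).mul_right _
  rw [map_mul, map_inv, map_mul, mul_inv_eq_one] at key
  exact key

/-- The character `θ₁ ⊗ θ₂` of `J_c` for `c ≥ 1` and `θ₁θ₂⁻¹` trivial on `1 + p ^ c ℤ_p`: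
`(a, b; c, d) ↦ (θ₁θ₂⁻¹)(a) · θ₂(ad - bc)`. If `θ₁` and `θ₂` are both trivial on `1 + p ^ c ℤ_p`
this is `θ₁(a) θ₂(d)`, see `typeChar_apply_of_trivialOn`. -/
def typeChar (θ₁ θ₂ : ℤ_[p]ˣ →* Lˣ) (c : ℕ) (hc : 1 ≤ c) (h : TrivialOn (θ₁ / θ₂) c) :
    J p c →* Lˣ :=
  MonoidHom.mk' (fun g => (θ₁ / θ₂) (upperLeft hc g) * θ₂ (Matrix.GeneralLinearGroup.det g.1))
    fun g g' => by
      rw [map_upperLeft_mul hc h, Subgroup.coe_mul, map_mul, map_mul, mul_mul_mul_comm]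

theorem typeChar_apply_of_trivialOn {θ₁ θ₂ : ℤ_[p]ˣ →* Lˣ} {c : ℕ} (hc : 1 ≤ c)
    (h : TrivialOn (θ₁ / θ₂) c) (h₂ : TrivialOn θ₂ c) (g : J p c) (d : ℤ_[p]ˣ)
    (hd : (d : ℤ_[p]) = g.1.val 1 1) :
    typeChar θ₁ θ₂ c hc h g = θ₁ (upperLeft hc g) * θ₂ d := by
  have key : θ₂ (Matrix.GeneralLinearGroup.det g.1 * (upperLeft hc g * d)⁻¹) = 1 := by
    apply h₂
    have hdet : ((Matrix.GeneralLinearGroup.det g.1 : ℤ_[p]ˣ) : ℤ_[p]) =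
        (upperLeft hc g : ℤ_[p]) * d - g.1.val 0 1 * g.1.val 1 0 := by
      rw [hd, val_upperLeft]
      exact Matrix.det_fin_two _
    have : ((Matrix.GeneralLinearGroup.det g.1 * (upperLeft hc g * d)⁻¹ : ℤ_[p]ˣ) : ℤ_[p]) - 1 =
        -(g.1.val 0 1 * g.1.val 1 0 * ((upperLeft hc g * d)⁻¹ : ℤ_[p]ˣ)) := by
      rw [Units.val_mul, hdet, sub_mul, ← Units.val_mul, ← Units.val_mul, mul_inv_cancel,
        Units.val_one]
      ring
    rw [this]
    exact dvd_neg.2 ((g.2.mul_left _).mul_right _)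
  rw [map_mul, map_inv, map_mul, mul_inv_eq_one] at key
  change (θ₁ / θ₂) (upperLeft hc g) * θ₂ (Matrix.GeneralLinearGroup.det g.1) = _
  rw [key, MonoidHom.div_apply, ← mul_assoc, div_mul_cancel]

/-- The smallest `c ≥ 1` such that `θ` is trivial on `1 + p ^ c ℤ_p`. -/
def conductor (θ : ℤ_[p]ˣ →* Lˣ) : ℕ := sInf {c | 1 ≤ c ∧ TrivialOn θ c}

theorem conductor_spec {θ : ℤ_[p]ˣ →* Lˣ} (hθ : IsSmoothChar θ) :
    1 ≤ conductor θ ∧ TrivialOn θ (conductor θ) :=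
  Nat.sInf_mem hθ.exists_trivialOn

open scoped Classical in
/-- The representation `τ(θ₁, θ₂)` of `K = GL₂(ℤ_p)` over `L`: it is `θ₁ ∘ det` if `θ₁ = θ₂`, and
otherwise it is `Ind_{J_c}^K (θ₁ ⊗ θ₂)`, with `c` the conductor of `θ₁θ₂⁻¹`: the functions
`f : K → L` with `f (h g) = (θ₁ ⊗ θ₂)(h) f (g)` for `h ∈ J_c`, acted on by right translation. (Such
functions are automatically locally constant, because the character of `J_c` is smooth and `J_c`
is open of finite index.) -/
def tau (θ₁ θ₂ : ℤ_[p]ˣ →* Lˣ) (h₁ : IsSmoothChar θ₁) (h₂ : IsSmoothChar θ₂) :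
    Rep L (GL (Fin 2) ℤ_[p]) :=
  if θ₁ = θ₂ then Rep.of (charRep (θ₁.comp Matrix.GeneralLinearGroup.det))
  else Rep.of (Representation.coind (J p (conductor (θ₁ / θ₂))).subtype
    (charRep (typeChar θ₁ θ₂ _ (conductor_spec (h₁.div h₂)).1 (conductor_spec (h₁.div h₂)).2)))

end Tau

/-- `σ` has central character `χ`: the scalar matrix `u ∈ ℤ_pˣ` acts by `χ(u)`. -/
def HasCentralChar {p : ℕ} [Fact p.Prime] {F : Type*} [Field F] {W : Type*} [AddCommGroup W]
    [Module F W] (σ : Representation F (GL (Fin 2) ℤ_[p]) W) (χ : ℤ_[p]ˣ →* Fˣ) : Prop :=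
  ∀ (u : ℤ_[p]ˣ) (w : W), σ (Matrix.GeneralLinearGroup.scalar (Fin 2) u) w = (χ u : F) • w

end PadicTypes

end

open PadicTypes

/-! An irreducible smooth `σ` in characteristic `p` contains an eigenvector `v` of the Iwahori
subgroup `J p 1`. The pro-`p` Iwahori subgroup fixes a nonzero vector, and the torus acts on its
fixed vectors through a finite group of order prime to `p`. By the central character, the
eigencharacter of `v` is `θ̄₁(a) θ̄₂(d) ω(d)^(k-2) ω(a/d)^j` for some `0 ≤ j ≤ p - 2`. It therefore
suffices to reach each of these `p - 1` characters.

This is done by Frobenius reciprocity on an integral submodule (`isSubquotient_of_eigenfunctional`).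
Suppose that `N` is a `K`-stable `A`-submodule of the `L`-representation and that `l : N → k_L` is a
semilinear functional on which `J p 1` acts by the eigencharacter of `v`. Then `x ↦ ∑ l(g x) • g⁻¹
v`, summed over `J p 1 \ K`, is an equivariant map `N → σ`. It is nonzero as soon as some `x` in `N`
has `l(g x) ≠ 0` for `g = 1` and `l(g x) = 0` for all `g` outside `J p 1`. By Artin–Rees such a map
already forces `σ` to be a subquotient of the reduction of every stable lattice
(`isSubquotient_of_equivariant`), so `N` itself need not be a lattice.

The functional and the test vector depend on the conductor. Write `n = k - 2`; an induced function
is evaluated at `1`.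

Conductor one (`isSubquotient_of_conductor_one`): `l` is the coefficient of `X₀^j X₁^(n-j)`, on
vectors whose translates have integral values at `1` with reduction divisible by `X₀^j`. The test
vector is the function supported on `J p 1` times `X₀^j X₁^(n-j)`. This needs `j ≤ n`, hence `k ≥
p`.

Equal characters (`isSubquotient_of_det`): `l` is the same coefficient, but there is no induction to
localise the test vector. The test vector is `D^j X₁^e (X₁^(p-1) - X₀^(p-1))`, where `D` is the
Dickson invariant; the last two factors produce the vanishing outside `J p 1`. This needs `n ≥
(p+1)j + p`, which gives the quadratic bound on `k`.

Conductor `c ≥ 2` (`isSubquotient_of_slope`): `J p 1` acts on `J p c \ J p 1` through affine maps of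
an `𝔽_p`-valued coordinate, the slope. Summing the `i`-th power of the slope against the coefficient
of `X₁^n` gives an eigenfunctional on the vectors killed by all lower such sums. Varying `i` yields
every power of `ω(d/a)`, whatever `k` is. -/

noncomputable section

namespace PadicTypes

set_option linter.unusedSectionVars false

/-! ### Subquotients of reductions of lattices. -/

section Lattice

open IsLocalRing

variable {A L : Type*} [CommRing A] [IsLocalRing A]
  [Field L] [Algebra A L] {G : Type*} [Group G]
  {V : Type*} [AddCommGroup V] [Module L V] [Module A V] [IsScalarTower A L V]
  {W : Type*} [AddCommGroup W] [Module (ResidueField A) W]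

/-- The kernel of `m ↦ 1 ⊗ m` is `𝔪 M`, and `𝔪` is principal. -/
theorem mem_smul_of_one_tmul_eq_zero {M : Type*} [AddCommGroup M] [Module A M] {ϖ : A}
    (hϖ : maximalIdeal A = Ideal.span {ϖ}) {m : M}
    (h : (1 : ResidueField A) ⊗ₜ[A] m = 0) : ∃ m' : M, m = ϖ • m' := by
  have h' : m ∈ LinearMap.ker (TensorProduct.mk A (A ⧸ maximalIdeal A) M 1) := h
  rw [LinearMap.ker_tensorProductMk, hϖ, Submodule.ideal_span_singleton_smul] at h'
  obtain ⟨m', -, rfl⟩ := h'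
  exact ⟨m', rfl⟩

/-- An equivariant semilinear map from a stable `A`-submodule `N` of a lattice quotient, killing
the elements divisible by `ϖ`, exhibits `σ` as a subquotient of the reduction. -/
theorem isSubquotient_baseChangeRep_of_submodule {M : Type*} [AddCommGroup M] [Module A M] {ϖ : A}
    (hϖ : maximalIdeal A = Ideal.span {ϖ}) (ρ : Representation A G M)
    (σ : Representation (ResidueField A) G W) (hσ : σ.IsIrreducible)
    (N : Submodule A M) (hN : ∀ g, ∀ m ∈ N, ρ g m ∈ N) (f : M → W)
    (hadd : ∀ x ∈ N, ∀ y ∈ N, f (x + y) = f x + f y)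
    (hsmul : ∀ a : A, ∀ x ∈ N, f (a • x) = residue A a • f x)
    (heq : ∀ g, ∀ x ∈ N, f (ρ g x) = σ g (f x))
    (hker : ∀ m, ϖ • m ∈ N → f (ϖ • m) = 0) (x : M) (hx : x ∈ N) (hfx : f x ≠ 0) :
    IsSubquotient σ (baseChangeRep (ResidueField A) ρ) := by
  have hwd : ∀ m ∈ N, ∀ m' ∈ N, (1 : ResidueField A) ⊗ₜ[A] m = 1 ⊗ₜ m' → f m = f m' := by
    intro m hm m' hm' h
    have h0 : (1 : ResidueField A) ⊗ₜ[A] (m - m') = 0 := by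
      rw [TensorProduct.tmul_sub, h, sub_self]
    obtain ⟨n, hn⟩ := mem_smul_of_one_tmul_eq_zero hϖ h0
    have hmem : m - m' ∈ N := N.sub_mem hm hm'
    have h1 := hker n (hn ▸ hmem)
    rw [← hn] at h1
    have h2 := hadd _ hmem _ hm'
    rwa [sub_add_cancel, h1, zero_add] at h2
  have hs : ∀ (a : A) (m : M), residue A a • ((1 : ResidueField A) ⊗ₜ[A] m) = 1 ⊗ₜ (a • m) := by
    intro a m
    rw [TensorProduct.smul_tmul', ← TensorProduct.smul_tmul, Algebra.smul_def (A := ResidueField A)]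
    rfl
  have hb : ∀ (g : G) (m : M), baseChangeRep (ResidueField A) ρ g ((1 : ResidueField A) ⊗ₜ[A] m) =
      1 ⊗ₜ (ρ g m) := fun g m => LinearMap.baseChange_tmul ..
  -- The image of `N` in `k ⊗ M` is `N / (N ∩ ϖM)`; `hker` says exactly that `f` factors through it.
  let S : Subrepresentation (baseChangeRep (ResidueField A) ρ) :=
    { toSubmodule :=
        { carrier := {z | ∃ m ∈ N, (1 : ResidueField A) ⊗ₜ[A] m = z}
          zero_mem' := ⟨0, N.zero_mem, TensorProduct.tmul_zero ..⟩
          add_mem' := by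
            rintro _ _ ⟨m, hm, rfl⟩ ⟨m', hm', rfl⟩
            exact ⟨m + m', N.add_mem hm hm', TensorProduct.tmul_add ..⟩
          smul_mem' := by
            rintro c _ ⟨m, hm, rfl⟩
            obtain ⟨a, rfl⟩ := residue_surjective c
            exact ⟨a • m, N.smul_mem a hm, (hs a m).symm⟩ }
      apply_mem_toSubmodule := by
        rintro g _ ⟨m, hm, rfl⟩
        exact ⟨ρ g m, hN g m hm, (hb g m).symm⟩ }
  have hS : ∀ z : S.toSubmodule, ∃ m ∈ N, (1 : ResidueField A) ⊗ₜ[A] m = z := fun z => z.2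
  choose c hc hcz using hS
  have hval : ∀ (z : S.toSubmodule) (m : M), m ∈ N → (1 : ResidueField A) ⊗ₜ[A] m = z →
      f (c z) = f m := fun z m hm h => hwd _ (hc z) _ hm ((hcz z).trans h.symm)
  let F : S.toSubmodule →ₗ[ResidueField A] W :=
    { toFun := fun z => f (c z)
      map_add' := fun z z' => by
        rw [← hadd _ (hc z) _ (hc z')]
        refine hval _ _ (N.add_mem (hc z) (hc z')) ?_
        rw [TensorProduct.tmul_add, hcz, hcz]
        rfl
      map_smul' := fun a z => by
        obtain ⟨a, rfl⟩ := residue_surjective a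
        rw [RingHom.id_apply, ← hsmul _ _ (hc z)]
        refine hval _ _ (N.smul_mem _ (hc z)) ?_
        rw [← hs, hcz]
        rfl }
  let F' : S.toRepresentation.IntertwiningMap σ :=
    F.intertwiningMap_of_isIntertwiningMap _ _ fun g z => by
      change f (c _) = σ g (f (c z))
      rw [← heq _ _ (hc z)]
      refine hval _ _ (hN _ _ (hc z)) ?_
      rw [← hb, hcz]
      rfl
  let z : S.toSubmodule := ⟨1 ⊗ₜ x, x, hx, rfl⟩
  let R : Subrepresentation σ :=
    { toSubmodule := LinearMap.range F
      apply_mem_toSubmodule := by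
        rintro g _ ⟨y, rfl⟩
        exact ⟨S.toRepresentation g y, F'.isIntertwining _ _ g y⟩ }
  have hzR : F z ∈ R.toSubmodule := ⟨z, rfl⟩
  have hz0 : F z ≠ 0 := fun h => hfx ((hval z x hx rfl).symm.trans h)
  refine ⟨S, F', fun w => ?_⟩
  rcases hσ.eq_bot_or_eq_top R with h | h
  · rw [h] at hzR
    exact absurd hzR hz0
  · have hw : w ∈ R.toSubmodule := by rw [h]; trivial
    exact hw

/-- If some stable `A`-submodule of the `L`-representation `ρ` maps nontrivially to `σ`, then `σ` is
a subquotient of the reduction of every stable lattice. -/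
theorem isSubquotient_of_equivariant [IsNoetherianRing A] {ϖ : A} (hϖ : maximalIdeal A = Ideal.span {ϖ})
    (hϖ0 : algebraMap A L ϖ ≠ 0) (ρ : Representation L G V) (M : Submodule A V) (hfg : M.FG)
    (hden : ∀ x : V, ∃ b : ℕ, ϖ ^ b • x ∈ M) (hM : IsStable ρ M)
    (σ : Representation (ResidueField A) G W) (hσ : σ.IsIrreducible)
    (N : Submodule A V) (hN : IsStable ρ N) (f : V → W)
    (hadd : ∀ x ∈ N, ∀ y ∈ N, f (x + y) = f x + f y)
    (hsmul : ∀ a : A, ∀ x ∈ N, f (a • x) = residue A a • f x)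
    (heq : ∀ g, ∀ x ∈ N, f (ρ g x) = σ g (f x)) (x : V) (hx : x ∈ N) (hfx : f x ≠ 0) :
    IsSubquotient σ (baseChangeRep (ResidueField A) (latticeRep ρ M hM)) := by
  classical
  obtain ⟨b, hb⟩ := hden x
  have : Module.Finite A M := Module.Finite.iff_fg.2 hfg
  have hres : residue A ϖ = 0 := by
    rw [residue_eq_zero_iff, hϖ]
    exact Ideal.mem_span_singleton_self ϖ
  -- The scalar `t i` is `ϖ^(i-b)`. The submodules `t i • M` shrink with `i`, and the one for `i =
  -- 0` contains `x`.
  let t : ℕ → L := fun i => algebraMap A L ϖ ^ i / algebraMap A L ϖ ^ b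
  have ht : ∀ i j, t (i + j) = algebraMap A L (ϖ ^ j) * t i := fun i j => by
    simp only [t, map_pow]
    ring
  have ht' : ∀ i j (v : V), t (i + j) • v = t i • (ϖ ^ j • v) := fun i j v => by
    rw [ht, ← algebraMap_smul L (ϖ ^ j) v, smul_smul, mul_comm]
  let N' : ℕ → Submodule A M := fun i =>
    N.comap (((LinearMap.lsmul L V (t i)).restrictScalars A).comp M.subtype)
  have hN' : ∀ i (m : M), m ∈ N' i ↔ t i • (m : V) ∈ N := fun i m => Iff.rfl
  -- Artin–Rees inside `M`: for large `i`, an element of `t i • M ∩ N` is `ϖ` times an element of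
  -- `N`, so semilinearity makes `f` vanish on it.
  have hex : ∃ i, ∀ m : M, m ∈ N' i → f (t i • (m : V)) = 0 := by
    obtain ⟨k₀, hk₀⟩ := Ideal.exists_pow_inf_eq_pow_smul (Ideal.span {ϖ}) (N' 0)
    refine ⟨k₀ + 1, fun m hm => ?_⟩
    have h1 : ϖ ^ (k₀ + 1) • m ∈ Ideal.span {ϖ} ^ (k₀ + 1) • (⊤ : Submodule A M) ⊓ N' 0 := by
      refine ⟨Submodule.smul_mem_smul (Ideal.pow_mem_pow (Ideal.mem_span_singleton_self ϖ) _)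
        trivial, ?_⟩
      rw [SetLike.mem_coe, hN', Submodule.coe_smul, ← ht', zero_add]
      exact hm
    rw [hk₀ _ (Nat.le_succ _), Nat.succ_sub le_rfl, Nat.sub_self, pow_one,
      Submodule.ideal_span_singleton_smul] at h1
    obtain ⟨m', hm', h2⟩ := h1
    have h3 := ht' 0 (k₀ + 1) (m : V)
    rw [zero_add] at h3
    have h4 : ϖ ^ (k₀ + 1) • (m : V) = ϖ • (m' : V) := congrArg Subtype.val h2.symm
    rw [h3, h4, smul_comm, hsmul _ _ ((hN' _ _).1 hm'.2), hres, zero_smul]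
  let i := Nat.find hex
  have hi : ∀ m : M, m ∈ N' i → f (t i • (m : V)) = 0 := Nat.find_spec hex
  have hi0 : i ≠ 0 := by
    intro h0
    refine hfx ?_
    have h1 : t 0 • (ϖ ^ b • x) = x := by
      rw [← ht', zero_add]
      simp only [t]
      rw [div_self (pow_ne_zero _ hϖ0), one_smul]
    have h2 := hi ⟨_, hb⟩
    rw [hN', h0] at h2
    simp only [h1] at h2
    exact h2 hx
  -- At the last index `j` where `f` survives on `t j • M ∩ N`, it kills the multiples of `ϖ`,
  -- because these lie in `t (j+1) • M`.
  obtain ⟨j, hj⟩ := Nat.exists_eq_succ_of_ne_zero hi0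
  have hjn : ¬ ∀ m : M, m ∈ N' j → f (t j • (m : V)) = 0 := Nat.find_min hex (by omega)
  push Not at hjn
  obtain ⟨m, hm, hfm⟩ := hjn
  refine isSubquotient_baseChangeRep_of_submodule hϖ _ σ hσ (N' j) ?_
    (fun m => f (t j • (m : V))) ?_ ?_ ?_ ?_ m hm hfm
  · intro g m hm
    rw [hN'] at hm ⊢
    change t j • ρ g (m : V) ∈ N
    rw [← map_smul]
    exact hN g _ hm
  · intro x hx y hy
    simp only [Submodule.coe_add, smul_add]
    exact hadd _ hx _ hy
  · intro a x hx
    simp only [Submodule.coe_smul]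
    rw [smul_comm]
    exact hsmul _ _ hx
  · intro g x hx
    rw [← heq _ _ ((hN' _ _).1 hx), map_smul]
    rfl
  · intro m hm
    have h1 : t j • (ϖ • (m : V)) = t i • (m : V) := by
      rw [hj, Nat.succ_eq_add_one, ht', pow_one]
    rw [hN'] at hm
    simp only [Submodule.coe_smul] at hm ⊢
    rw [h1] at hm ⊢
    exact hi m hm

end Lattice

/-! ### Sums over `H \ G`. -/

section CosetSum

variable {G : Type*} [Group G] (H : Subgroup G) {X : Type*} [AddCommMonoid X]

/-- The sum over `H \ G` of a left `H`-invariant function on `G`. -/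
def cosetSum [Fintype (G ⧸ H)] (φ : G → X) : X := ∑ q : G ⧸ H, φ q.out⁻¹

variable {H}

/-- Inversion turns the left cosets of Mathlib's quotient into right cosets, so a left-invariant
function does not see the chosen representative. -/
theorem apply_out_inv {Y : Type*} {φ : G → Y} (hφ : ∀ h ∈ H, ∀ g, φ (h * g) = φ g) (g : G) :
    φ ((g : G ⧸ H).out⁻¹) = φ g⁻¹ := by
  have h1 : (g⁻¹ * (g : G ⧸ H).out) ∈ H := QuotientGroup.eq.1 (QuotientGroup.out_eq' _).symm
  rw [← hφ _ h1]
  group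

theorem cosetSum_mul_right [Fintype (G ⧸ H)] {φ : G → X} (hφ : ∀ h ∈ H, ∀ g, φ (h * g) = φ g) (g : G) :
    cosetSum H (fun x => φ (x * g)) = cosetSum H φ := by
  unfold cosetSum
  refine Fintype.sum_equiv (MulAction.toPerm g⁻¹) _ _ fun q => ?_
  have h1 : MulAction.toPerm g⁻¹ q = ((g⁻¹ * q.out : G) : G ⧸ H) := by
    conv_lhs => rw [← QuotientGroup.out_eq' q]
    rfl
  rw [h1, apply_out_inv hφ]
  simp

theorem cosetSum_eq_of_support [Fintype (G ⧸ H)] {φ : G → X} (hφ : ∀ h ∈ H, ∀ g, φ (h * g) = φ g) {ι : Type*}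
    (s : Finset ι) (r : ι → G) (hr : ∀ i ∈ s, ∀ j ∈ s, r i * (r j)⁻¹ ∈ H → i = j)
    (h0 : ∀ g, (∀ i ∈ s, g * (r i)⁻¹ ∉ H) → φ g = 0) : cosetSum H φ = ∑ i ∈ s, φ (r i) := by
  classical
  unfold cosetSum
  have hinj : Set.InjOn (fun i => (((r i)⁻¹ : G) : G ⧸ H)) s := by
    intro i hi j hj hij
    refine hr i hi j hj ?_
    have := QuotientGroup.eq.1 hij
    rwa [inv_inv] at this
  rw [← Finset.sum_subset (Finset.subset_univ (s.image fun i => (((r i)⁻¹ : G) : G ⧸ H))),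
    Finset.sum_image hinj]
  · refine Finset.sum_congr rfl fun i _ => ?_
    rw [apply_out_inv hφ, inv_inv]
  · intro q _ hq
    refine h0 _ fun i hi hmem => hq (Finset.mem_image.2 ⟨i, hi, ?_⟩)
    rw [← QuotientGroup.out_eq' q]
    refine QuotientGroup.eq.2 ?_
    rw [inv_inv]
    simpa using H.inv_mem hmem

end CosetSum

/-! ### Frobenius reciprocity for eigenfunctionals. -/

section Frobenius

open IsLocalRing

variable {A L : Type*} [CommRing A] [IsLocalRing A]
  [Field L] [Algebra A L] {G : Type*} [Group G]
  {V : Type*} [AddCommGroup V] [Module L V] [Module A V] [IsScalarTower A L V]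
  {W : Type*} [AddCommGroup W] [Module (ResidueField A) W]

/-- An `H`-eigenfunctional on a stable submodule with a test vector supported on `H`, together with
an `H`-eigenvector of `σ` for the same character, exhibits `σ` as a subquotient of the reduction
of every stable lattice. -/
theorem isSubquotient_of_eigenfunctional [IsNoetherianRing A] {ϖ : A}
    (hϖ : maximalIdeal A = Ideal.span {ϖ})
    (hϖ0 : algebraMap A L ϖ ≠ 0) (ρ : Representation L G V) (M : Submodule A V) (hfg : M.FG)
    (hden : ∀ x : V, ∃ b : ℕ, ϖ ^ b • x ∈ M) (hM : IsStable ρ M)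
    (σ : Representation (ResidueField A) G W) (hσ : σ.IsIrreducible)
    (H : Subgroup G) [Finite (G ⧸ H)] (χ : G → ResidueField A) (v : W) (hv0 : v ≠ 0)
    (hv : ∀ h ∈ H, σ h v = χ h • v)
    (N : Submodule A V) (hN : IsStable ρ N) (l : V → ResidueField A)
    (hadd : ∀ x ∈ N, ∀ y ∈ N, l (x + y) = l x + l y)
    (hsmul : ∀ a : A, ∀ x ∈ N, l (a • x) = residue A a * l x)
    (heq : ∀ h ∈ H, ∀ x ∈ N, l (ρ h x) = χ h * l x) (x : V) (hx : x ∈ N) (hlx : l x ≠ 0)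
    (hsupp : ∀ g, g ∉ H → l (ρ g x) = 0) :
    IsSubquotient σ (baseChangeRep (ResidueField A) (latticeRep ρ M hM)) := by
  have : Fintype (G ⧸ H) := Fintype.ofFinite _
  let Φ : V → G → W := fun x g => l (ρ g x) • σ g⁻¹ v
  -- The factor `χ h` from the functional cancels the inverse factor from `σ h⁻¹ v`.
  have hΦ : ∀ x ∈ N, ∀ h ∈ H, ∀ g, Φ x (h * g) = Φ x g := by
    intro x hx h hh g
    have h1 : χ h • σ h⁻¹ v = v := by
      rw [← map_smul, ← hv h hh, ← Module.End.mul_apply, ← map_mul, inv_mul_cancel, map_one]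
      rfl
    simp only [Φ]
    rw [map_mul, Module.End.mul_apply, heq h hh _ (hN g x hx), mul_inv_rev, map_mul,
      Module.End.mul_apply, mul_comm, mul_smul, ← map_smul, h1]
  refine isSubquotient_of_equivariant hϖ hϖ0 ρ M hfg hden hM σ hσ N hN
    (fun x => cosetSum H (Φ x)) ?_ ?_ ?_ x hx ?_
  · intro x hx y hy
    simp only [cosetSum, Φ]
    rw [← Finset.sum_add_distrib]
    refine Finset.sum_congr rfl fun q _ => ?_
    rw [map_add, hadd _ (hN _ _ hx) _ (hN _ _ hy), add_smul]
  · intro a x hx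
    simp only [cosetSum, Φ]
    rw [Finset.smul_sum]
    refine Finset.sum_congr rfl fun q _ => ?_
    rw [← algebraMap_smul L a x, map_smul, algebraMap_smul, hsmul _ _ (hN _ _ hx), mul_smul]
  · intro g x hx
    have h1 : (fun y => Φ x (y * g)) = fun y => l (ρ y (ρ g x)) • σ (g⁻¹ * y⁻¹) v := by
      funext y
      simp only [Φ]
      rw [map_mul, Module.End.mul_apply, mul_inv_rev]
    change cosetSum H (Φ (ρ g x)) = σ g (cosetSum H (Φ x))
    rw [← cosetSum_mul_right (hΦ x hx) g, h1]
    simp only [cosetSum, Φ]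
    rw [map_sum]
    refine Finset.sum_congr rfl fun q _ => ?_
    rw [map_smul, ← Module.End.mul_apply (σ g), ← map_mul σ, mul_inv_cancel_left]
  -- Only the trivial coset contributes for the test vector, and its term is `l x • v`.
  · have h1 : cosetSum H (Φ x) = ∑ i ∈ ({()} : Finset Unit), Φ x 1 := by
      refine cosetSum_eq_of_support (hΦ x hx) {()} (fun _ => 1) (fun _ _ _ _ _ => rfl) ?_
      intro g hg
      have : g ∉ H := by simpa using hg () (by simp)
      simp only [Φ]
      rw [hsupp g this, zero_smul]
    change cosetSum H (Φ x) ≠ 0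
    rw [h1]
    simp [Φ, hlx, hv0]

end Frobenius

/-! ### Congruence subgroups and the pro-`p` Iwahori subgroup. -/

section Congruence

variable {p : ℕ} [Fact p.Prime]

/-- The diagonal matrix with entries `a`, `d`. -/
def diagGL {R : Type*} [CommRing R] (a d : Rˣ) : GL (Fin 2) R where
  val := !![(a : R), 0; 0, (d : R)]
  inv := !![((a⁻¹ : Rˣ) : R), 0; 0, ((d⁻¹ : Rˣ) : R)]
  val_inv := by
    ext i j
    fin_cases i <;> fin_cases j <;> simp
  inv_val := by
    ext i j
    fin_cases i <;> fin_cases j <;> simp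

theorem diagGL_mul {R : Type*} [CommRing R] (a d a' d' : Rˣ) :
    diagGL (a * a') (d * d') = diagGL a d * diagGL a' d' := by
  ext i j
  fin_cases i <;> fin_cases j <;> simp [diagGL]

theorem diagGL_one {R : Type*} [CommRing R] : diagGL (1 : Rˣ) 1 = 1 := by
  ext i j
  fin_cases i <;> fin_cases j <;> simp [diagGL]

theorem scalar_eq_diagGL {R : Type*} [CommRing R] (a : Rˣ) :
    Matrix.GeneralLinearGroup.scalar (Fin 2) a = diagGL a a := by
  ext i j
  fin_cases i <;> fin_cases j <;> simp [diagGL]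

theorem toZMod_eq_zero_iff (x : ℤ_[p]) : PadicInt.toZMod x = 0 ↔ (p : ℤ_[p]) ∣ x := by
  rw [← RingHom.mem_ker, PadicInt.ker_toZMod, PadicInt.maximalIdeal_eq_span_p,
    Ideal.mem_span_singleton]

/-- Reduction of matrices modulo `p ^ m`. -/
def redGL (p : ℕ) [Fact p.Prime] (m : ℕ) : GL (Fin 2) ℤ_[p] →* GL (Fin 2) (ZMod (p ^ m)) :=
  Matrix.GeneralLinearGroup.map (PadicInt.toZModPow m)

theorem redGL_eq_one_iff {m : ℕ} {g : GL (Fin 2) ℤ_[p]} :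
    redGL p m g = 1 ↔ ∃ Y, (g : Matrix (Fin 2) (Fin 2) ℤ_[p]) = 1 + (p : ℤ_[p]) ^ m • Y := by
  have h1 : redGL p m g = 1 ↔ ∀ i j, (p : ℤ_[p]) ^ m ∣ g.val i j - (1 : Matrix _ _ ℤ_[p]) i j := by
    rw [Matrix.GeneralLinearGroup.ext_iff]
    refine forall_congr' fun i => forall_congr' fun j => ?_
    rw [← Ideal.mem_span_singleton, ← PadicInt.ker_toZModPow, RingHom.mem_ker, map_sub, sub_eq_zero]
    have : ((1 : GL (Fin 2) (ZMod (p ^ m))).val i j) =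
        PadicInt.toZModPow m ((1 : Matrix (Fin 2) (Fin 2) ℤ_[p]) i j) := by
      rw [Units.val_one, Matrix.one_apply, Matrix.one_apply]
      split_ifs <;> simp
    rw [this]
    rfl
  rw [h1]
  constructor
  · intro h
    choose Y hY using h
    refine ⟨Matrix.of Y, ?_⟩
    ext i j
    simp [← hY]
  · rintro ⟨Y, hY⟩ i j
    rw [hY]
    exact ⟨Y i j, by simp⟩

/-- The pro-`p` Iwahori subgroup. -/
def proIwahori (p : ℕ) [Fact p.Prime] : Subgroup (GL (Fin 2) ℤ_[p]) where
  carrier := {g | PadicInt.toZMod (g.val 0 0) = 1 ∧ PadicInt.toZMod (g.val 1 0) = 0 ∧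
    PadicInt.toZMod (g.val 1 1) = 1}
  one_mem' := by simp
  mul_mem' := by
    rintro g h ⟨h1, h2, h3⟩ ⟨h4, h5, h6⟩
    simp [Matrix.mul_apply, Fin.sum_univ_two, h1, h2, h3, h4, h5, h6]
  inv_mem' := by
    rintro g ⟨h1, h2, h3⟩
    have h : ∀ i j, PadicInt.toZMod ((g.val * (g⁻¹).val) i j) =
        PadicInt.toZMod ((1 : Matrix (Fin 2) (Fin 2) ℤ_[p]) i j) := by
      intro i j
      rw [← Units.val_mul, mul_inv_cancel, Units.val_one]
    simp only [Matrix.mul_apply, Fin.sum_univ_two, map_add, map_mul] at h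
    have e00 := h 0 0
    have e10 := h 1 0
    have e11 := h 1 1
    simp only [h1, h2, h3, Matrix.one_apply, one_mul, zero_mul, zero_add, map_one, if_true,
      Fin.reduceEq, if_false, map_zero] at e00 e10 e11
    rw [e10, mul_zero, add_zero] at e00
    exact ⟨e00, e10, e11⟩

theorem mem_proIwahori {g : GL (Fin 2) ℤ_[p]} : g ∈ proIwahori p ↔
    PadicInt.toZMod (g.val 0 0) = 1 ∧ PadicInt.toZMod (g.val 1 0) = 0 ∧
      PadicInt.toZMod (g.val 1 1) = 1 := Iff.rfl

theorem diagGL_conj_mem_proIwahori {g : GL (Fin 2) ℤ_[p]} (hg : g ∈ proIwahori p)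
    (a d : ℤ_[p]ˣ) : (diagGL a d)⁻¹ * g * diagGL a d ∈ proIwahori p := by
  obtain ⟨h1, h2, h3⟩ := hg
  have hinv : (diagGL a d)⁻¹ = diagGL a⁻¹ d⁻¹ := by
    rw [inv_eq_iff_mul_eq_one, ← diagGL_mul, mul_inv_cancel, mul_inv_cancel, diagGL_one]
  have hu : ∀ u : ℤ_[p]ˣ,
      PadicInt.toZMod ((u⁻¹ : ℤ_[p]ˣ) : ℤ_[p]) * PadicInt.toZMod (u : ℤ_[p]) = 1 := by
    intro u
    rw [← map_mul, Units.inv_mul, map_one]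
  rw [mem_proIwahori, hinv]
  simp only [Units.val_mul, Matrix.mul_apply, Fin.sum_univ_two, map_add, map_mul]
  simpa [diagGL, h1, h2, h3] using And.intro (hu a) (hu d)

/-- Modulo `p` the element is upper unipotent, and such matrices have `p`-th power `1`. -/
theorem pow_mem_ker_redGL_one {g : GL (Fin 2) ℤ_[p]} (hg : g ∈ proIwahori p) :
    ∃ Y, ((g ^ p : GL (Fin 2) ℤ_[p]) : Matrix (Fin 2) (Fin 2) ℤ_[p]) = 1 + (p : ℤ_[p]) • Y := by
  obtain ⟨h1, h2, h3⟩ := hg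
  have key : ∀ n : ℕ, ((g.val.map PadicInt.toZMod) ^ n : Matrix (Fin 2) (Fin 2) (ZMod p)) =
      !![1, n * PadicInt.toZMod (g.val 0 1); 0, 1] := by
    intro n
    induction n with
    | zero =>
      ext i j
      fin_cases i <;> fin_cases j <;> simp
    | succ n ih =>
      rw [pow_succ, ih]
      ext i j
      fin_cases i <;> fin_cases j <;>
        simp [Matrix.mul_apply, Fin.sum_univ_two, h1, h2, h3]
      ring
  have h4 : ∀ i j, (p : ℤ_[p]) ∣ (g ^ p).val i j - (1 : Matrix _ _ ℤ_[p]) i j := by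
    intro i j
    rw [← toZMod_eq_zero_iff, map_sub, sub_eq_zero]
    have h5 := congrFun (congrFun (key p) i) j
    rw [← RingHom.mapMatrix_apply, ← map_pow, ← Units.val_pow_eq_pow_val] at h5
    rw [RingHom.mapMatrix_apply, Matrix.map_apply] at h5
    rw [h5]
    fin_cases i <;> fin_cases j <;> simp
  choose Y hY using h4
  refine ⟨Matrix.of Y, ?_⟩
  ext i j
  simp [← hY]

/-- Matrices do not commute, so the congruence `(1 + pX)^(p^m) ≡ 1` modulo `p^(m+1)` is taken in
`ℤ_p[X]` and then specialised at `X = Y`, where `g^p = 1 + pY`. -/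
theorem proIwahori_pow_mem_ker {g : GL (Fin 2) ℤ_[p]} (hg : g ∈ proIwahori p) (m : ℕ) :
    redGL p (m + 1) (g ^ (p ^ (m + 1))) = 1 := by
  obtain ⟨Y, hY⟩ := pow_mem_ker_redGL_one hg
  rw [redGL_eq_one_iff]
  have h1 : (p : Polynomial ℤ_[p]) ∣ (1 + (p : Polynomial ℤ_[p]) * Polynomial.X) - 1 :=
    ⟨Polynomial.X, by ring⟩
  obtain ⟨R, hR⟩ := dvd_sub_pow_of_dvd_sub h1 m
  have h2 := congrArg (Polynomial.aeval Y) hR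
  simp only [map_sub, map_pow, map_add, map_mul, map_one, Polynomial.aeval_X, map_natCast,
    one_pow] at h2
  refine ⟨Polynomial.aeval Y R, ?_⟩
  have h3 : (p : ℤ_[p]) • Y = (p : Matrix (Fin 2) (Fin 2) ℤ_[p]) * Y := by
    rw [← nsmul_eq_mul, Nat.cast_smul_eq_nsmul]
  have h4 : (p : ℤ_[p]) ^ (m + 1) • (Polynomial.aeval Y R) =
      (p : Matrix (Fin 2) (Fin 2) ℤ_[p]) ^ (m + 1) * Polynomial.aeval Y R := by
    rw [← Nat.cast_pow, ← Nat.cast_pow, ← nsmul_eq_mul, Nat.cast_smul_eq_nsmul]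
  rw [pow_succ', pow_mul, Units.val_pow_eq_pow_val, hY, h4, h3, ← h2]
  abel

/-- The topology on units comes from `g ↦ (g, g⁻¹)`, so both `g` and its inverse must be close to
`1`; the congruence kernel is closed under inversion. -/
theorem exists_redGL_ker_subset {S : Set (GL (Fin 2) ℤ_[p])} (hS : IsOpen S) (h1 : (1 : GL (Fin 2) ℤ_[p]) ∈ S) :
    ∃ m : ℕ, ∀ g : GL (Fin 2) ℤ_[p], redGL p m g = 1 → g ∈ S := by
  obtain ⟨U, hU, rfl⟩ := (Units.isEmbedding_embedProduct.isOpen_iff).1 hS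
  have hmem : U ∈ nhds ((1 : Matrix (Fin 2) (Fin 2) ℤ_[p]), MulOpposite.op (1 : Matrix (Fin 2) (Fin 2) ℤ_[p])) :=
    hU.mem_nhds (by
      simpa only [Set.mem_preimage, Units.embedProduct_apply, inv_one, Units.val_one] using h1)
  obtain ⟨U₁, hU₁, U₂, hU₂, hsub⟩ := mem_nhds_prod_iff.1 hmem
  have hU₂' : (MulOpposite.op ⁻¹' U₂ : Set (Matrix (Fin 2) (Fin 2) ℤ_[p])) ∈
      nhds (1 : Matrix (Fin 2) (Fin 2) ℤ_[p]) :=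
    MulOpposite.continuous_op.continuousAt.preimage_mem_nhds hU₂
  have hI := Filter.inter_mem hU₁ hU₂'
  obtain ⟨ε, hε, hball⟩ := (Metric.mem_nhds_iff (α := Fin 2 → Fin 2 → ℤ_[p])).1 hI
  obtain ⟨m, hm⟩ := PadicInt.exists_pow_neg_lt p hε
  have hin : ∀ g : GL (Fin 2) ℤ_[p], redGL p m g = 1 → g.val ∈ U₁ ∩ (MulOpposite.op ⁻¹' U₂) := by
    intro g hg
    obtain ⟨Y, hY⟩ := redGL_eq_one_iff.1 hg
    apply hball
    change dist (α := Fin 2 → Fin 2 → ℤ_[p]) g.val (1 : Matrix (Fin 2) (Fin 2) ℤ_[p]) < ε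
    refine (dist_pi_lt_iff hε).2 fun i => (dist_pi_lt_iff hε).2 fun j => ?_
    rw [dist_eq_norm]
    refine lt_of_le_of_lt ?_ hm
    rw [PadicInt.norm_le_pow_iff_mem_span_pow, Ideal.mem_span_singleton]
    refine ⟨Y i j, ?_⟩
    have := congrFun (congrFun hY i) j
    rw [this]
    simp
  refine ⟨m, fun g hg => hsub ⟨(hin g hg).1, (hin g⁻¹ ?_).2⟩⟩
  rw [map_inv, hg, inv_one]

end Congruence

/-! ### Iwahori eigenvectors in irreducible smooth representations. -/

section Eigenvector

variable {p : ℕ} [Fact p.Prime] {F : Type*} [Field F]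
  {W : Type*} [AddCommGroup W] [Module F W]

/-- A smooth irreducible representation is trivial on a principal congruence subgroup. -/
theorem exists_forall_redGL_eq_one {σ : Representation F (GL (Fin 2) ℤ_[p]) W}
    (hσ : σ.IsIrreducible) (hsm : IsSmoothRep σ) :
    ∃ m : ℕ, ∀ g, redGL p m g = 1 → ∀ w, σ g w = w := by
  obtain ⟨w₀, hw₀⟩ : ∃ w : W, w ≠ 0 := by
    by_contra! h
    refine hσ.bot_ne_top (SetLike.ext fun w => ?_)
    rw [h w]
    exact ⟨fun _ => Submodule.zero_mem _, fun _ => Submodule.zero_mem _⟩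
  obtain ⟨m, hm⟩ := exists_redGL_ker_subset (hsm w₀) (by simp)
  -- The congruence subgroup is normal, so its fixed vectors form a subrepresentation, which is
  -- everything by irreducibility.
  let R : Subrepresentation σ :=
    { toSubmodule :=
        { carrier := {w | ∀ g, redGL p m g = 1 → σ g w = w}
          zero_mem' := fun g _ => map_zero _
          add_mem' := fun hx hy g hg => by rw [map_add, hx g hg, hy g hg]
          smul_mem' := fun c x hx g hg => by rw [map_smul, hx g hg] }
      apply_mem_toSubmodule := fun h w hw g hg => by
        have h1 : redGL p m (h⁻¹ * g * h) = 1 := by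
          rw [map_mul, map_mul, hg, mul_one, ← map_mul, inv_mul_cancel, map_one]
        have h2 : g * h = h * (h⁻¹ * g * h) := by group
        rw [← Module.End.mul_apply, ← map_mul, h2, map_mul, Module.End.mul_apply, hw _ h1] }
  have hR : w₀ ∈ R.toSubmodule := fun g hg => hm g hg
  refine ⟨m, fun g hg w => ?_⟩
  rcases hσ.eq_bot_or_eq_top R with h | h
  · rw [h] at hR
    exact absurd hR hw₀
  · have hw : w ∈ R.toSubmodule := by rw [h]; trivial
    exact hw g hg

/-- The `𝔽_p`-span of one `K`-orbit is a finite set of `p`-power cardinality on which the pro-`p`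
Iwahori subgroup acts through a `p`-group. The number of fixed points is divisible by `p`, so `0` is
not the only one. Working over `𝔽_p` instead of `F` keeps the span finite. -/
theorem exists_proIwahori_fixed_of_module [Module (ZMod p) W] {σ : Representation F (GL (Fin 2) ℤ_[p]) W}
    (hσ : σ.IsIrreducible) (hsm : IsSmoothRep σ) :
    ∃ u : W, u ≠ 0 ∧ ∀ g ∈ proIwahori p, σ g u = u := by
  obtain ⟨m, hm⟩ := exists_forall_redGL_eq_one hσ hsm
  obtain ⟨w₀, hw₀⟩ : ∃ w : W, w ≠ 0 := by
    by_contra! h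
    refine hσ.bot_ne_top (SetLike.ext fun w => ?_)
    rw [h w]
    exact ⟨fun _ => Submodule.zero_mem _, fun _ => Submodule.zero_mem _⟩
  have hfin : (Set.range fun g => σ g w₀).Finite := by
    have hfac : ∀ g g', redGL p m g = redGL p m g' → σ g w₀ = σ g' w₀ := by
      intro g g' h
      have h1 : redGL p m (g'⁻¹ * g) = 1 := by rw [map_mul, map_inv, h, inv_mul_cancel]
      have h2 : σ g w₀ = σ g' (σ (g'⁻¹ * g) w₀) := by
        rw [← Module.End.mul_apply, ← map_mul, mul_inv_cancel_left]
      rw [h2, hm _ h1]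
    have hf : Set.Finite (Set.range (redGL p m)) := Set.toFinite _
    have : (fun g => σ g w₀) = (fun x => σ (Function.invFun (redGL p m) x) w₀) ∘ redGL p m := by
      funext g
      exact hfac _ _ (Function.invFun_eq ⟨g, rfl⟩).symm
    rw [this, Set.range_comp]
    exact hf.image _
  let S : Submodule (ZMod p) W := Submodule.span (ZMod p) (Set.range fun g => σ g w₀)
  have hSfin : Module.Finite (ZMod p) ↥S := Module.Finite.span_of_finite _ hfin
  have hSfin' : Finite S := Module.finite_of_finite (ZMod p)
  have hw₀S : w₀ ∈ S := Submodule.subset_span ⟨1, by simp⟩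
  have hstab : ∀ g, ∀ w ∈ S, σ g w ∈ S := by
    intro g w hw
    induction hw using Submodule.span_induction with
    | mem x hx =>
      obtain ⟨h, rfl⟩ := hx
      refine Submodule.subset_span ⟨g * h, ?_⟩
      simp
    | zero => rw [map_zero]; exact S.zero_mem
    | add x y _ _ hx hy => rw [map_add]; exact S.add_mem hx hy
    | smul a x _ hx =>
      rw [← ZMod.natCast_zmod_val a, Nat.cast_smul_eq_nsmul, map_nsmul]
      exact S.nsmul_mem hx _
  have hcard : p ∣ Nat.card S := by
    have : Fintype S := Fintype.ofFinite S
    have : Nontrivial S := ⟨⟨w₀, hw₀S⟩, 0, fun h => hw₀ (congrArg Subtype.val h)⟩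
    rw [Nat.card_eq_fintype_card, Module.card_eq_pow_finrank (K := ZMod p), ZMod.card]
    exact dvd_pow_self _ (Module.finrank_pos).ne'
  let : MulAction (proIwahori p) S :=
    { smul := fun g s => ⟨σ g.1 s.1, hstab _ _ s.2⟩
      one_smul := fun s => Subtype.ext (by change σ 1 s.1 = s.1; rw [map_one]; rfl)
      mul_smul := fun g h s => Subtype.ext (by
        change σ (g.1 * h.1) s.1 = σ g.1 (σ h.1 s.1)
        rw [map_mul]; rfl) }
  have hP : IsPGroup p (MulAction.toPermHom (proIwahori p) S).range := by
    rintro ⟨_, g, rfl⟩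
    refine ⟨m + 1, Subtype.ext ?_⟩
    change (MulAction.toPermHom (proIwahori p) S g) ^ p ^ (m + 1) = 1
    rw [← map_pow]
    ext s
    change σ ((g ^ p ^ (m + 1) : proIwahori p) : GL (Fin 2) ℤ_[p]) s.1 = s.1
    refine hm _ ?_ _
    have h1 := proIwahori_pow_mem_ker g.2 m
    obtain ⟨Y, hY⟩ := redGL_eq_one_iff.1 h1
    refine redGL_eq_one_iff.2 ⟨(p : ℤ_[p]) • Y, ?_⟩
    rw [smul_smul, ← pow_succ]
    exact hY
  have h0 : (0 : S) ∈ MulAction.fixedPoints (MulAction.toPermHom (proIwahori p) S).range S := by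
    rintro ⟨_, g, rfl⟩
    exact Subtype.ext (map_zero (σ g.1))
  obtain ⟨b, hb, hb0⟩ := hP.exists_fixed_point_of_prime_dvd_card_of_fixed_point S hcard h0
  refine ⟨b, fun h => hb0 (Subtype.ext h.symm), fun g hg => ?_⟩
  exact congrArg Subtype.val (hb ⟨_, ⟨g, hg⟩, rfl⟩)

theorem exists_proIwahori_fixed [CharP F p] {σ : Representation F (GL (Fin 2) ℤ_[p]) W}
    (hσ : σ.IsIrreducible) (hsm : IsSmoothRep σ) :
    ∃ u : W, u ≠ 0 ∧ ∀ g ∈ proIwahori p, σ g u = u := by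
  let : Module (ZMod p) W := AddCommGroup.zmodModule (n := p) fun x => by
    rw [← Nat.cast_smul_eq_nsmul F, CharP.cast_eq_zero, zero_smul]
  exact exists_proIwahori_fixed_of_module hσ hsm

variable [CharP F p] (r : ℤ_[p] →+* F)

theorem ringHom_eq_zero_iff (x : ℤ_[p]) : r x = 0 ↔ (p : ℤ_[p]) ∣ x := by
  constructor
  · intro h
    by_contra hx
    have hu : IsUnit x := by
      by_contra hn
      refine hx ?_
      rw [← Ideal.mem_span_singleton, ← PadicInt.maximalIdeal_eq_span_p]
      exact hn
    exact (hu.map r).ne_zero h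
  · rintro ⟨y, rfl⟩
    rw [map_mul, map_natCast, CharP.cast_eq_zero, zero_mul]

/-- The kernel of reduction modulo `p` on `ℤ_pˣ`. -/
abbrev oneUnits (p : ℕ) [Fact p.Prime] : Subgroup ℤ_[p]ˣ :=
  (Units.map (PadicInt.toZMod (p := p)).toMonoidHom).ker

theorem mem_oneUnits {u : ℤ_[p]ˣ} : u ∈ oneUnits p ↔ (p : ℤ_[p]) ∣ (u : ℤ_[p]) - 1 := by
  rw [← toZMod_eq_zero_iff, map_sub, map_one, sub_eq_zero, MonoidHom.mem_ker, Units.ext_iff]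
  rfl

theorem mem_oneUnits_iff_ringHom {u : ℤ_[p]ˣ} : u ∈ oneUnits p ↔ r u = 1 := by
  rw [mem_oneUnits, ← ringHom_eq_zero_iff r, map_sub, map_one, sub_eq_zero]

theorem ringHom_unit_pow (u : ℤ_[p]ˣ) : r u ^ (p - 1) = 1 := by
  rw [← map_pow, ← Units.val_pow_eq_pow_val, ← mem_oneUnits_iff_ringHom, MonoidHom.mem_ker,
    map_pow, ZMod.units_pow_card_sub_one_eq_one]

/-- A smooth irreducible representation in characteristic `p` with central character `χ` contains
an eigenvector of the Iwahori subgroup. -/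
theorem exists_iwahori_eigenvector {σ : Representation F (GL (Fin 2) ℤ_[p]) W}
    (hσ : σ.IsIrreducible) (hsm : IsSmoothRep σ) {χ : ℤ_[p]ˣ →* Fˣ} (hχ : HasCentralChar σ χ)
    (η : ℤ_[p]ˣ →* Fˣ) (hη : ∀ u ∈ oneUnits p, η u = 1) :
    ∃ j < p - 1, ∃ v : W, v ≠ 0 ∧ ∀ h ∈ J p 1, ∀ a d : ℤ_[p]ˣ, (a : ℤ_[p]) = h.val 0 0 →
      (d : ℤ_[p]) = h.val 1 1 →
      σ h v = ((η (a * d⁻¹) * Units.map r.toMonoidHom (a * d⁻¹) ^ j * χ d : Fˣ) : F) • v := by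
  classical
  obtain ⟨u, hu0, hu⟩ := exists_proIwahori_fixed hσ hsm
  have : Finite (ℤ_[p]ˣ ⧸ oneUnits p) := Subgroup.finite_quotient_of_finiteIndex
  have : Fintype (ℤ_[p]ˣ ⧸ oneUnits p) := Fintype.ofFinite _
  set ω : ℤ_[p]ˣ →* Fˣ := Units.map r.toMonoidHom with hω
  have hωmem : ∀ x : ℤ_[p]ˣ, x ∈ oneUnits p ↔ ω x = 1 := fun x => by
    rw [mem_oneUnits_iff_ringHom r, Units.ext_iff]
    rfl
  have hdiag : ∀ a ∈ oneUnits p, diagGL a 1 ∈ proIwahori p := by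
    intro a ha
    rw [mem_oneUnits, ← toZMod_eq_zero_iff, map_sub, map_one, sub_eq_zero] at ha
    exact ⟨ha, map_zero _, map_one _⟩
  have hfix : ∀ (a : ℤ_[p]ˣ) (w : W), (∀ g ∈ proIwahori p, σ g w = w) →
      ∀ g ∈ proIwahori p, σ g (σ (diagGL a 1) w) = σ (diagGL a 1) w := by
    intro a w hw g hg
    have h2 : g * diagGL a 1 = diagGL a 1 * ((diagGL a 1)⁻¹ * g * diagGL a 1) := by group
    rw [← Module.End.mul_apply, ← map_mul, h2, map_mul, Module.End.mul_apply,
      hw _ (diagGL_conj_mem_proIwahori hg a 1)]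
  -- Up to the factor `p - 1`, summing `Φ j` over `ℤ_pˣ` modulo `1 + pℤ_p` projects `u` to the part
  -- where `diag(a, 1)` acts by `η ω^j`.
  let Φ : ℕ → ℤ_[p]ˣ → W := fun j a => ((η a * ω a ^ j : Fˣ)⁻¹ : Fˣ) • σ (diagGL a 1) u
  have hΦ : ∀ j, ∀ h ∈ oneUnits p, ∀ a, Φ j (h * a) = Φ j a := by
    intro j h hh a
    have h1 : diagGL (h * a) 1 = diagGL a 1 * diagGL h 1 := by
      rw [← diagGL_mul, mul_comm, mul_one]
    simp only [Φ]
    rw [h1, map_mul, map_mul, hη h hh, (hωmem h).1 hh, map_mul, Module.End.mul_apply,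
      hu _ (hdiag h hh), one_mul, one_mul]
  let w : ℕ → W := fun j => cosetSum (oneUnits p) (Φ j)
  have hwfix : ∀ j, ∀ g ∈ proIwahori p, σ g (w j) = w j := by
    intro j g hg
    simp only [w, cosetSum, Φ, map_sum]
    refine Finset.sum_congr rfl fun q _ => ?_
    rw [Units.smul_def, map_smul, hfix _ u hu g hg]
  have hwdiag : ∀ j a, σ (diagGL a 1) (w j) = ((η a * ω a ^ j : Fˣ) : F) • w j := by
    intro j a
    have h1 : w j = cosetSum (oneUnits p) (fun x => Φ j (x * a)) :=
      (cosetSum_mul_right (hΦ j) a).symm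
    conv_rhs => rw [h1]
    simp only [w, cosetSum, Φ, map_sum, Finset.smul_sum]
    refine Finset.sum_congr rfl fun q _ => ?_
    have h2 : diagGL ((Quotient.out q)⁻¹ * a) 1 = diagGL a 1 * diagGL (Quotient.out q)⁻¹ 1 := by
      rw [← diagGL_mul, mul_comm, mul_one]
    rw [h2, map_mul σ, Module.End.mul_apply, Units.smul_def, map_smul, Units.smul_def, smul_smul,
      ← Units.val_mul]
    congr 2
    rw [map_mul, map_mul, mul_pow, mul_mul_mul_comm, mul_inv (_ * _) (η a * ω a ^ j),
      mul_comm _ (η a * ω a ^ j)⁻¹, mul_inv_cancel_left]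
  -- By orthogonality of characters the projections add up to `(p - 1) u = -u`, so they cannot all
  -- vanish.
  obtain ⟨j, hj, hwj⟩ : ∃ j < p - 1, w j ≠ 0 := by
    by_contra! h
    have h1 : ∑ j ∈ Finset.range (p - 1), w j = 0 :=
      Finset.sum_eq_zero fun j hj => h j (Finset.mem_range.1 hj)
    have h2 : ∑ j ∈ Finset.range (p - 1), w j =
        cosetSum (oneUnits p) (fun a => ∑ j ∈ Finset.range (p - 1), Φ j a) := by
      simp only [w, cosetSum]
      rw [Finset.sum_comm]
    have h3 : ∀ a, a ∉ oneUnits p → ∑ j ∈ Finset.range (p - 1), Φ j a = 0 := by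
      intro a ha
      have h4 : ∑ j ∈ Finset.range (p - 1), ((ω a)⁻¹ : F) ^ j = 0 := by
        have h5 := mul_geom_sum ((ω a)⁻¹ : F) (p - 1)
        have h6 : ((ω a)⁻¹ : F) ^ (p - 1) = 1 := by
          rw [inv_pow, inv_eq_one]
          · exact ringHom_unit_pow r a
        rw [h6, sub_self] at h5
        refine (mul_eq_zero.1 h5).resolve_left fun h7 => ha ((hωmem a).2 ?_)
        rw [sub_eq_zero, inv_eq_one] at h7
        exact Units.ext h7
      have h8 : ∑ j ∈ Finset.range (p - 1), Φ j a =
          (∑ j ∈ Finset.range (p - 1), ((ω a)⁻¹ : F) ^ j) • ((η a)⁻¹ : F) • σ (diagGL a 1) u := by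
        rw [Finset.sum_smul]
        refine Finset.sum_congr rfl fun j _ => ?_
        simp only [Φ]
        rw [Units.smul_def, smul_smul]
        congr 1
        simp [mul_comm]
      rw [h8, h4, zero_smul]
    have h9 := cosetSum_eq_of_support (H := oneUnits p)
      (φ := fun a => ∑ j ∈ Finset.range (p - 1), Φ j a)
      (fun h hh a => Finset.sum_congr rfl fun j _ => hΦ j h hh a) ({()} : Finset Unit)
      (fun _ => 1) (fun _ _ _ _ _ => rfl)
      (fun a ha => h3 a (by simpa using ha () (by simp)))
    rw [← h2, h1] at h9
    simp only [Φ, diagGL_one, map_one, Finset.card_singleton, Module.End.one_apply, one_pow, one_mul, inv_one, one_smul,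
      Finset.sum_const, Finset.card_range] at h9
    have h10 : (p - 1 : ℕ) • u = -u := by
      rw [← Nat.cast_smul_eq_nsmul F, Nat.cast_sub (Fact.out : p.Prime).one_lt.le,
        CharP.cast_eq_zero, Nat.cast_one, zero_sub, neg_one_smul]
    refine hu0 (neg_eq_zero.1 ?_)
    rw [← h10]
    exact h9.symm
  refine ⟨j, hj, w j, hwj, fun h hh a d ha hd => ?_⟩
  have hi : (diagGL a d)⁻¹ * h ∈ proIwahori p := by
    have hinv : (diagGL a d)⁻¹ = diagGL a⁻¹ d⁻¹ := by
      rw [inv_eq_iff_mul_eq_one, ← diagGL_mul, mul_inv_cancel, mul_inv_cancel, diagGL_one]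
    have h10 : PadicInt.toZMod (h.val 1 0) = 0 := by
      rw [toZMod_eq_zero_iff]
      have := hh
      change (p : ℤ_[p]) ^ 1 ∣ _ at this
      rwa [pow_one] at this
    rw [mem_proIwahori, hinv]
    simp only [Units.val_mul, Matrix.mul_apply, Fin.sum_univ_two, map_add, map_mul]
    have e : ∀ x : ℤ_[p]ˣ, PadicInt.toZMod (x : ℤ_[p]) ≠ 0 := fun x =>
      (x.isUnit.map PadicInt.toZMod).ne_zero
    simp [diagGL, ← ha, ← hd, h10, e]
  -- The first factor acts by the torus eigencharacter, the scalar by the central character, and the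
  -- last lies in the pro-`p` Iwahori subgroup.
  have hdec : h = diagGL (a * d⁻¹) 1 * (diagGL d d * ((diagGL a d)⁻¹ * h)) := by
    have : diagGL (a * d⁻¹) 1 * diagGL d d = diagGL a d := by
      rw [← diagGL_mul, inv_mul_cancel_right, one_mul]
    rw [← mul_assoc, this, mul_inv_cancel_left]
  conv_lhs => rw [hdec]
  rw [map_mul, map_mul σ (diagGL d d), Module.End.mul_apply, Module.End.mul_apply, hwfix j _ hi,
    ← scalar_eq_diagGL, hχ, map_smul, hwdiag, smul_smul, ← Units.val_mul]
  rw [mul_comm]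

end Eigenvector

/-! ### Reduction of integral polynomials and the action of upper triangular matrices. -/

section Reduction

open MvPolynomial IsLocalRing

theorem map_substGL {R S : Type*} [CommRing R] [CommRing S] (f : R →+* S) (g : GL (Fin 2) R)
    (P : MvPolynomial (Fin 2) R) :
    map f (substGL R g P) = substGL S (Matrix.GeneralLinearGroup.map f g) (map f P) := by
  induction P using MvPolynomial.induction_on with
  | C a => simp [substGL]
  | add P Q hP hQ => rw [map_add, map_add, hP, hQ, map_add, map_add]
  | mul_X P i hP => 
    rw [map_mul, map_mul, hP, map_mul, map_mul]
    congr 1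
    fin_cases i <;> simp [substGL]

/-- The exponent of `X₀ ^ i X₁ ^ m`. -/
abbrev biExp (i m : ℕ) : Fin 2 →₀ ℕ := Finsupp.single 0 i + Finsupp.single 1 m

section Borel

variable {F : Type*} [Field F]

theorem coeff_biExp_X_pow_mul (j m : ℕ) (P : MvPolynomial (Fin 2) F) :
    coeff (biExp j m) (X 0 ^ j * P) = coeff (Finsupp.single 1 m) P := by
  rw [X_pow_eq_monomial, coeff_monomial_mul, one_mul]

theorem coeff_single_one (m : ℕ) (P : MvPolynomial (Fin 2) F) :
    coeff (Finsupp.single 1 m) P =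
      (aeval (![0, Polynomial.X] : Fin 2 → Polynomial F) P).coeff m := by
  induction P using MvPolynomial.induction_on' with
  | add P Q hP hQ => rw [coeff_add, hP, hQ, map_add, Polynomial.coeff_add]
  | monomial d a =>
    rw [coeff_monomial, aeval_monomial, Finsupp.prod_fintype _ _ (by simp), Fin.prod_univ_two]
    simp only [Matrix.cons_val_zero, Matrix.cons_val_one, Polynomial.algebraMap_eq,
      Polynomial.coeff_C_mul]
    have h1 : d = Finsupp.single 1 m ↔ d 0 = 0 ∧ d 1 = m := by
      rw [Finsupp.ext_iff, Fin.forall_fin_two]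
      simp
    simp only [h1]
    by_cases h0 : d 0 = 0
    · simp [h0, Polynomial.coeff_X_pow, eq_comm]
    · simp [h0]

/-- Setting `X₀ = 0` reads off this coefficient, and modulo `X₀` an upper triangular substitution is
just `X₁ ↦ d X₁`. -/
theorem coeff_single_one_substGL {g : GL (Fin 2) F} (m : ℕ) (P : MvPolynomial (Fin 2) F) (hg : g.val 1 0 = 0) :
    coeff (Finsupp.single 1 m) (substGL F g P) = g.val 1 1 ^ m * coeff (Finsupp.single 1 m) P := by
  have h1 : aeval (![0, Polynomial.X] : Fin 2 → Polynomial F) (substGL F g P) =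
      (aeval (![0, Polynomial.X] : Fin 2 → Polynomial F) P).comp
        (Polynomial.C (g.val 1 1) * Polynomial.X) := by
    induction P using MvPolynomial.induction_on with
    | C a => simp [substGL]
    | add P Q hP hQ => rw [map_add, map_add, hP, hQ, map_add, Polynomial.add_comp]
    | mul_X P i hP =>
      rw [map_mul, map_mul, hP, map_mul, Polynomial.mul_comp]
      congr 1
      fin_cases i <;> simp [substGL, hg]
  rw [coeff_single_one, h1, Polynomial.comp_C_mul_X_coeff, coeff_single_one, mul_comm]

/-- The line spanned by `X₀` is stable under the Borel subgroup, so after dividing by `X₀^j` the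
claim becomes the case `j = 0`. Without the divisibility, lower powers of `X₀` would contribute. -/
theorem X_zero_pow_dvd_substGL {g : GL (Fin 2) F} {j : ℕ} {P : MvPolynomial (Fin 2) F} (m : ℕ)
    (hg : g.val 1 0 = 0) (hP : X 0 ^ j ∣ P) : coeff (biExp j m) (substGL F g P) =
      g.val 0 0 ^ j * g.val 1 1 ^ m * coeff (biExp j m) P := by
  obtain ⟨Q, rfl⟩ := hP
  have h1 : substGL F g (X 0) = C (g.val 0 0) * X 0 := by simp [substGL, hg]
  rw [map_mul, map_pow, h1, mul_pow, mul_assoc, ← C_pow, coeff_C_mul, coeff_biExp_X_pow_mul,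
    coeff_biExp_X_pow_mul, coeff_single_one_substGL m Q hg, mul_assoc]

end Borel

variable {A L : Type*} [CommRing A] [IsLocalRing A] [Field L] [Algebra A L]

/-- `Q` is the reduction of the integral polynomial `P`. -/
def IsRed (P : MvPolynomial (Fin 2) L) (Q : MvPolynomial (Fin 2) (ResidueField A)) : Prop :=
  ∃ R : MvPolynomial (Fin 2) A, map (algebraMap A L) R = P ∧ map (residue A) R = Q

open scoped Classical in
/-- The reduction of an integral element of `L` (and `0` for other elements). -/
def redVal (A : Type*) [CommRing A] [IsLocalRing A] [Algebra A L] (x : L) : ResidueField A :=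
  if h : ∃ a : A, algebraMap A L a = x then residue A h.choose else 0

namespace IsRed

variable {P P' : MvPolynomial (Fin 2) L} {Q Q' : MvPolynomial (Fin 2) (ResidueField A)}

theorem zero : IsRed (0 : MvPolynomial (Fin 2) L) (0 : MvPolynomial (Fin 2) (ResidueField A)) :=
  ⟨0, map_zero _, map_zero _⟩

theorem add (h : IsRed P Q) (h' : IsRed P' Q') : IsRed (P + P') (Q + Q') := by
  obtain ⟨R, rfl, rfl⟩ := h
  obtain ⟨R', rfl, rfl⟩ := h'
  exact ⟨R + R', map_add _ _ _, map_add _ _ _⟩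

theorem smul (a : A) (h : IsRed P Q) : IsRed (algebraMap A L a • P) (residue A a • Q) := by
  obtain ⟨R, rfl, rfl⟩ := h
  exact ⟨C a * R, by rw [map_mul, map_C, smul_eq_C_mul], by rw [map_mul, map_C, smul_eq_C_mul]⟩

theorem substGL {p : ℕ} [Fact p.Prime] [Algebra ℤ_[p] A] [Algebra ℤ_[p] L]
    [IsScalarTower ℤ_[p] A L] (g : GL (Fin 2) ℤ_[p]) (h : IsRed P Q) :
    IsRed (PadicTypes.substGL L (Matrix.GeneralLinearGroup.map (algebraMap ℤ_[p] L) g) P)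
      (PadicTypes.substGL (ResidueField A) (Matrix.GeneralLinearGroup.map
        ((residue A).comp (algebraMap ℤ_[p] A)) g) Q) := by
  obtain ⟨R, rfl, rfl⟩ := h
  refine ⟨PadicTypes.substGL A (Matrix.GeneralLinearGroup.map (algebraMap ℤ_[p] A) g) R, ?_, ?_⟩
  · rw [map_substGL, IsScalarTower.algebraMap_eq ℤ_[p] A L]
    rfl
  · rw [map_substGL]
    rfl

variable [FaithfulSMul A L]

theorem redVal_coeff (h : IsRed P Q) (d : Fin 2 →₀ ℕ) : redVal A (coeff d P) = coeff d Q := by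
  obtain ⟨R, rfl, rfl⟩ := h
  have hex : ∃ a : A, algebraMap A L a = coeff d (map (algebraMap A L) R) :=
    ⟨coeff d R, (coeff_map _ _ _).symm⟩
  rw [redVal, dif_pos hex, coeff_map (residue A)]
  congr 1
  apply FaithfulSMul.algebraMap_injective A L
  rw [hex.choose_spec, coeff_map]

end IsRed

end Reduction

/-! ### Criterion using a coefficient as Iwahori eigenfunctional. -/

section Criterion

open MvPolynomial IsLocalRing

variable {p : ℕ} [Fact p.Prime] {A L : Type*} [CommRing A] [IsLocalRing A]
  [Field L] [Algebra A L] [FaithfulSMul A L] [Algebra ℤ_[p] A] [Algebra ℤ_[p] L]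
  [IsScalarTower ℤ_[p] A L] [CharP (ResidueField A) p]
  {V : Type*} [AddCommGroup V] [Module L V] [Module A V] [IsScalarTower A L V]
  {W : Type*} [AddCommGroup W] [Module (ResidueField A) W]

theorem finite_quotient_J (p : ℕ) [Fact p.Prime] (c : ℕ) : Finite (GL (Fin 2) ℤ_[p] ⧸ J p c) := by
  have h1 : (redGL p c).ker ≤ J p c := by
    intro g hg
    obtain ⟨Y, hY⟩ := redGL_eq_one_iff.1 hg
    change (p : ℤ_[p]) ^ c ∣ g.val 1 0
    rw [hY]
    exact ⟨Y 1 0, by simp⟩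
  have : (J p c).FiniteIndex := Subgroup.finiteIndex_of_le h1
  infer_instance

theorem resHom_eq_zero_of_mem_J {h : GL (Fin 2) ℤ_[p]} (hh : h ∈ J p 1) :
    ((residue A).comp (algebraMap ℤ_[p] A)) (h.val 1 0) = 0 := by
  rw [ringHom_eq_zero_iff]
  have h1 : (p : ℤ_[p]) ^ 1 ∣ h.val 1 0 := hh
  rwa [pow_one] at h1

/-- Criterion with the coefficient of `X₀ ^ j X₁ ^ m` as Iwahori eigenfunctional. -/
theorem isSubquotient_of_coeff [IsNoetherianRing A] {ϖ : A} (hϖ : maximalIdeal A = Ideal.span {ϖ})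
    (hϖ0 : algebraMap A L ϖ ≠ 0) (ρ : Representation L (GL (Fin 2) ℤ_[p]) V) (M : Submodule A V)
    (hfg : M.FG) (hden : ∀ x : V, ∃ b : ℕ, ϖ ^ b • x ∈ M) (hM : IsStable ρ M)
    (σ : Representation (ResidueField A) (GL (Fin 2) ℤ_[p]) W) (hσ : σ.IsIrreducible)
    (ev : V →ₗ[L] MvPolynomial (Fin 2) L) (χ : GL (Fin 2) ℤ_[p] → A)
    (hev : ∀ h ∈ J p 1, ∀ x, ev (ρ h x) = algebraMap A L (χ h) •
      substGL L (Matrix.GeneralLinearGroup.map (algebraMap ℤ_[p] L) h) (ev x))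
    (j m : ℕ) (v : W) (hv0 : v ≠ 0)
    (hv : ∀ h ∈ J p 1, σ h v = (residue A (χ h) *
      (residue A (algebraMap ℤ_[p] A (h.val 0 0)) ^ j *
        residue A (algebraMap ℤ_[p] A (h.val 1 1)) ^ m)) • v)
    (x : V) (Q : GL (Fin 2) ℤ_[p] → MvPolynomial (Fin 2) (ResidueField A))
    (hQ : ∀ g, IsRed (ev (ρ g x)) (Q g)) (hdvd : ∀ g, X 0 ^ j ∣ Q g)
    (hQ1 : coeff (biExp j m) (Q 1) ≠ 0) (hQ0 : ∀ g, g ∉ J p 1 → coeff (biExp j m) (Q g) = 0) :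
    IsSubquotient σ (baseChangeRep (ResidueField A) (latticeRep ρ M hM)) := by
  have := finite_quotient_J p 1
  -- Integrality and divisibility are imposed on all translates, so that `N` is stable under the
  -- whole group.
  let N : Submodule A V :=
    { carrier := {x | ∀ g, ∃ Q : MvPolynomial (Fin 2) (ResidueField A),
        IsRed (ev (ρ g x)) Q ∧ X 0 ^ j ∣ Q}
      zero_mem' := fun g => ⟨0, by rw [map_zero, map_zero]; exact IsRed.zero, dvd_zero _⟩
      add_mem' := fun {x y} hx hy g => by
        obtain ⟨Q, h1, h2⟩ := hx g
        obtain ⟨Q', h3, h4⟩ := hy g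
        exact ⟨Q + Q', by rw [map_add, map_add]; exact h1.add h3, dvd_add h2 h4⟩
      smul_mem' := fun a x hx g => by
        obtain ⟨Q, h1, h2⟩ := hx g
        refine ⟨residue A a • Q, ?_, h2.trans ⟨C (residue A a), by rw [smul_eq_C_mul, mul_comm]⟩⟩
        rw [← algebraMap_smul L a x, map_smul, map_smul]
        exact h1.smul a }
  have hN1 : ∀ x ∈ N, ∃ Q : MvPolynomial (Fin 2) (ResidueField A),
      IsRed (ev x) Q ∧ X 0 ^ j ∣ Q := by
    intro x hx
    have := hx 1
    rwa [map_one] at this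
  refine isSubquotient_of_eigenfunctional hϖ hϖ0 ρ M hfg hden hM σ hσ (J p 1) _ v hv0 hv N ?_
    (fun x => redVal A (coeff (biExp j m) (ev x))) ?_ ?_ ?_ x (fun g => ⟨Q g, hQ g, hdvd g⟩) ?_ ?_
  · intro g x hx g'
    obtain ⟨Q, h1, h2⟩ := hx (g' * g)
    exact ⟨Q, by rwa [map_mul] at h1, h2⟩
  · intro x hx y hy
    obtain ⟨Q, h1, -⟩ := hN1 x hx
    obtain ⟨Q', h2, -⟩ := hN1 y hy
    have h3 := h1.add h2
    rw [← map_add] at h3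
    rw [h1.redVal_coeff, h2.redVal_coeff, h3.redVal_coeff, coeff_add]
  · intro a x hx
    obtain ⟨Q, h1, -⟩ := hN1 x hx
    have h3 := h1.smul a
    rw [← map_smul, algebraMap_smul] at h3
    rw [h1.redVal_coeff, h3.redVal_coeff, coeff_smul, smul_eq_mul]
  · intro h hh x hx
    obtain ⟨Q, h1, h2⟩ := hN1 x hx
    have h3 := (h1.substGL h).smul (χ h)
    rw [← hev h hh] at h3
    rw [h1.redVal_coeff, h3.redVal_coeff, coeff_smul, smul_eq_mul,
      X_zero_pow_dvd_substGL m (resHom_eq_zero_of_mem_J hh) h2, mul_assoc]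
    simp [mul_assoc]
  · have h1 := hQ 1
    rw [map_one] at h1
    have h2 : redVal A (coeff (biExp j m) (ev x)) = _ := h1.redVal_coeff _
    rw [h2]
    exact hQ1
  · intro g hg
    rw [(hQ g).redVal_coeff]
    exact hQ0 g hg

end Criterion

/-! ### Power sums over `𝔽_p`. -/

section PowerSums

theorem sum_range_pow_eq_sum_zmod {p : ℕ} [Fact p.Prime] {F : Type*} [Field F] [CharP F p] (e : ℕ) :
    ∑ y ∈ Finset.range p, (y : F) ^ e = ZMod.castHom (dvd_refl p) F (∑ z : ZMod p, z ^ e) := by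
  rw [map_sum]
  refine Finset.sum_bij (fun y _ => (y : ZMod p)) (fun _ _ => Finset.mem_univ _) ?_ ?_ ?_
  · intro a ha b hb hab
    rw [ZMod.natCast_eq_natCast_iff] at hab
    exact hab.eq_of_lt_of_lt (Finset.mem_range.1 ha) (Finset.mem_range.1 hb)
  · intro z _
    exact ⟨z.val, Finset.mem_range.2 (ZMod.val_lt z), ZMod.natCast_zmod_val z⟩
  · intro y _
    rw [map_pow, map_natCast]

/-- For `e = 0` the convention `0 ^ 0 = 1` matters: the sum is then `p = 0`. -/
theorem sum_range_pow_eq_zero {p : ℕ} [Fact p.Prime] {F : Type*} [Field F] [CharP F p] {e : ℕ}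
    (he : e < p - 1) : ∑ y ∈ Finset.range p, (y : F) ^ e = 0 := by
  rw [sum_range_pow_eq_sum_zmod, FiniteField.sum_pow_lt_card_sub_one (ZMod p) e
    (by rwa [ZMod.card]), map_zero]

theorem sum_range_pow_ne_zero {p : ℕ} [Fact p.Prime] {F : Type*} [Field F] [CharP F p] :
    ∑ y ∈ Finset.range p, (y : F) ^ (p - 1) ≠ 0 := by
  classical
  have hp := (Fact.out : p.Prime).two_le
  have h1 : ∀ z : ZMod p, z ^ (p - 1) = if z = 0 then 0 else 1 := by
    intro z
    split_ifs with h
    · rw [h, zero_pow (by omega)]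
    · exact ZMod.pow_card_sub_one_eq_one h
  rw [sum_range_pow_eq_sum_zmod, map_ne_zero]
  simp only [h1]
  rw [Finset.sum_ite, Finset.sum_const_zero, zero_add, Finset.sum_const, nsmul_one,
    Finset.filter_not, Finset.filter_eq' _ (0 : ZMod p), if_pos (Finset.mem_univ _),
    Finset.card_sdiff_of_subset (by simp)]
  simp only [Finset.card_univ, ZMod.card, Finset.card_singleton]
  rw [Nat.cast_sub (by omega)]
  simp

end PowerSums

/-! ### The slope coordinate on `J p c \ J p 1` for `c ≥ 2`. -/

section Slope

variable {p : ℕ} [Fact p.Prime] {F : Type*} [Field F] [CharP F p] (r : ℤ_[p] →+* F)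

theorem J_le_J {c : ℕ} (hc : 1 ≤ c) : J p c ≤ J p 1 := fun _ hg => (pow_dvd_pow _ hc).trans hg

instance (c : ℕ) : Finite (J p 1 ⧸ (J p c).subgroupOf (J p 1)) := by
  have := finite_quotient_J p c
  have : (J p c).FiniteIndex := Subgroup.finiteIndex_of_finite_quotient
  infer_instance

instance (c : ℕ) : Fintype (J p 1 ⧸ (J p c).subgroupOf (J p 1)) := Fintype.ofFinite _

theorem dvd_of_mem_J_one {g : GL (Fin 2) ℤ_[p]} (hg : g ∈ J p 1) : (p : ℤ_[p]) ∣ g.val 1 0 := by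
  have h1 : (p : ℤ_[p]) ^ 1 ∣ g.val 1 0 := hg
  rwa [pow_one] at h1

theorem isUnit_diag_of_mem_J_one {g : GL (Fin 2) ℤ_[p]} (hg : g ∈ J p 1) :
    IsUnit (g.val 0 0) ∧ IsUnit (g.val 1 1) := by
  have h1 : IsUnit (g.val 0 0) := isUnit_apply_zero_zero le_rfl ⟨g, hg⟩
  refine ⟨h1, ?_⟩
  have hdet : IsUnit (g.val.det) := g.isUnit.map Matrix.detMonoidHom
  rw [Matrix.det_fin_two] at hdet
  by_contra h
  have h11 : g.val 1 1 ∈ IsLocalRing.maximalIdeal ℤ_[p] := h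
  have h10 : g.val 1 0 ∈ IsLocalRing.maximalIdeal ℤ_[p] := by
    rw [PadicInt.maximalIdeal_eq_span_p, Ideal.mem_span_singleton]
    exact dvd_of_mem_J_one hg
  exact (Ideal.sub_mem _ (Ideal.mul_mem_left _ _ h11) (Ideal.mul_mem_left _ _ h10) :
    g.val 0 0 * g.val 1 1 - g.val 0 1 * g.val 1 0 ∈ IsLocalRing.maximalIdeal ℤ_[p]) hdet

theorem ringHom_diag_ne_zero {g : GL (Fin 2) ℤ_[p]} (hg : g ∈ J p 1) :
    r (g.val 0 0) ≠ 0 ∧ r (g.val 1 1) ≠ 0 :=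
  ⟨((isUnit_diag_of_mem_J_one hg).1.map r).ne_zero, ((isUnit_diag_of_mem_J_one hg).2.map r).ne_zero⟩

open scoped Classical in
/-- Division by `p` of a multiple of `p`. -/
def divP (x : ℤ_[p]) : ℤ_[p] := if h : (p : ℤ_[p]) ∣ x then h.choose else 0

theorem mul_divP {x : ℤ_[p]} (h : (p : ℤ_[p]) ∣ x) : p * divP x = x := by
  rw [divP, dif_pos h]
  exact h.choose_spec.symm

theorem divP_eq {x y : ℤ_[p]} (h : x = p * y) : divP x = y := by
  have hp : (p : ℤ_[p]) ≠ 0 := by exact_mod_cast (Fact.out : p.Prime).ne_zero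
  exact mul_left_cancel₀ hp ((mul_divP ⟨y, h⟩).trans h)

/-- The coordinate on `J_2 \ J_1`. -/
def slope (g : GL (Fin 2) ℤ_[p]) : F := r (divP (g.val 1 0)) / r (g.val 1 1)

theorem ringHom_val_mul_one_one {g h : GL (Fin 2) ℤ_[p]} (hg : g ∈ J p 1) :
    r ((g * h).val 1 1) = r (g.val 1 1) * r (h.val 1 1) := by
  have h1 : r (g.val 1 0) = 0 := (ringHom_eq_zero_iff r _).2 (dvd_of_mem_J_one hg)
  rw [Units.val_mul, Matrix.mul_apply, Fin.sum_univ_two, map_add, map_mul, map_mul, h1, zero_mul,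
    zero_add]

theorem divP_val_mul {g h : GL (Fin 2) ℤ_[p]} (hg : g ∈ J p 1) (hh : h ∈ J p 1) :
    divP ((g * h).val 1 0) = divP (g.val 1 0) * h.val 0 0 + g.val 1 1 * divP (h.val 1 0) := by
  refine divP_eq ?_
  rw [Units.val_mul, Matrix.mul_apply, Fin.sum_univ_two]
  nth_rw 1 [← mul_divP (dvd_of_mem_J_one hg), ← mul_divP (dvd_of_mem_J_one hh)]
  ring

/-- Right translation by `h` in `J p 1` is an affine map of the slope. It is solved for the slope of
`g` because sums over cosets are reindexed by `g ↦ g h`. -/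
theorem slope_mul {g h : GL (Fin 2) ℤ_[p]} (hg : g ∈ J p 1) (hh : h ∈ J p 1) :
    slope r g = r (h.val 1 1) / r (h.val 0 0) * slope r (g * h) -
      r (divP (h.val 1 0)) / r (h.val 0 0) := by
  obtain ⟨h1, h2⟩ := ringHom_diag_ne_zero r hg
  obtain ⟨h3, h4⟩ := ringHom_diag_ne_zero r hh
  rw [slope, slope, divP_val_mul hg hh, ringHom_val_mul_one_one r hg, map_add, map_mul, map_mul]
  field_simp
  ring

/-- Here `c ≥ 2` is essential: the lower left entry of `h` divided by `p` still reduces to `0`. -/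
theorem slope_mul_of_mem_J {c : ℕ} (hc : 2 ≤ c) {g h : GL (Fin 2) ℤ_[p]} (hg : g ∈ J p 1)
    (hh : h ∈ J p c) : slope r (h * g) = slope r g := by
  have hh1 : h ∈ J p 1 := J_le_J (by omega) hh
  obtain ⟨h1, h2⟩ := ringHom_diag_ne_zero r hg
  obtain ⟨h3, h4⟩ := ringHom_diag_ne_zero r hh1
  have h5 : r (divP (h.val 1 0)) = 0 := by
    rw [ringHom_eq_zero_iff]
    have h6 : (p : ℤ_[p]) ^ 2 ∣ h.val 1 0 := (pow_dvd_pow _ hc).trans hh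
    obtain ⟨y, hy⟩ := h6
    exact ⟨y, divP_eq (by rw [hy]; ring)⟩
  rw [slope, slope, divP_val_mul hh1 hg, ringHom_val_mul_one_one r hh1, map_add, map_mul, map_mul,
    h5, zero_mul, zero_add, mul_div_mul_left _ _ h4]

/-- The lower unipotent matrix with entry `p y`. -/
def lowerP (p : ℕ) [Fact p.Prime] (y : ℤ_[p]) : GL (Fin 2) ℤ_[p] where
  val := !![1, 0; p * y, 1]
  inv := !![1, 0; -(p * y), 1]
  val_inv := by
    ext i j
    fin_cases i <;> fin_cases j <;> simp
  inv_val := by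
    ext i j
    fin_cases i <;> fin_cases j <;> simp

theorem lowerP_mem_J (y : ℤ_[p]) : lowerP p y ∈ J p 1 := by
  change (p : ℤ_[p]) ^ 1 ∣ p * y
  rw [pow_one]
  exact dvd_mul_right _ _

theorem slope_lowerP (y : ℤ_[p]) : slope r (lowerP p y) = r y := by
  have : divP ((lowerP p y).val 1 0) = y := divP_eq rfl
  rw [slope, this]
  simp [lowerP]

end Slope

/-! ### Criterion for conductor at least two: moments of the slope. -/

section SlopeCriterion

open MvPolynomial IsLocalRing

variable {p : ℕ} [Fact p.Prime] {A L : Type*} [CommRing A] [IsLocalRing A]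
  [Field L] [Algebra A L] [FaithfulSMul A L] [Algebra ℤ_[p] A] [Algebra ℤ_[p] L]
  [IsScalarTower ℤ_[p] A L] [CharP (ResidueField A) p]
  {V : Type*} [AddCommGroup V] [Module L V] [Module A V] [IsScalarTower A L V]
  {W : Type*} [AddCommGroup W] [Module (ResidueField A) W]

/-- The vectors all of whose translates have integral image under `ev`. -/
def integralPart (A : Type*) [CommRing A] [IsLocalRing A] [Algebra A L] [Module A V]
    [IsScalarTower A L V] {G : Type*} [Group G] (ρ : Representation L G V)
    (ev : V →ₗ[L] MvPolynomial (Fin 2) L) : Submodule A V where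
  carrier := {x | ∀ g, ∃ Q : MvPolynomial (Fin 2) (ResidueField A), IsRed (ev (ρ g x)) Q}
  zero_mem' := fun g => ⟨0, by rw [map_zero, map_zero]; exact IsRed.zero⟩
  add_mem' := fun {x y} hx hy g => by
    obtain ⟨Q, h1⟩ := hx g
    obtain ⟨Q', h3⟩ := hy g
    exact ⟨Q + Q', by rw [map_add, map_add]; exact h1.add h3⟩
  smul_mem' := fun a x hx g => by
    obtain ⟨Q, h1⟩ := hx g
    refine ⟨residue A a • Q, ?_⟩
    rw [← algebraMap_smul L a x, map_smul, map_smul]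
    exact h1.smul a

variable (A) in
/-- The reduction of the coefficient of `X₁ ^ n`. -/
def topCoeff (ev : V →ₗ[L] MvPolynomial (Fin 2) L) (n : ℕ) (x : V) : ResidueField A :=
  redVal A (coeff (Finsupp.single 1 n) (ev x))

section

variable {G : Type*} [Group G] {ρ : Representation L G V}
  {ev : V →ₗ[L] MvPolynomial (Fin 2) L} {n : ℕ}

theorem apply_mem_integralPart {x : V} (hx : x ∈ integralPart A ρ ev) (g : G) :
    ρ g x ∈ integralPart A ρ ev := fun g' => by
  obtain ⟨Q, h1⟩ := hx (g' * g)
  exact ⟨Q, by rwa [map_mul] at h1⟩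

theorem exists_isRed {x : V} (hx : x ∈ integralPart A ρ ev) :
    ∃ Q : MvPolynomial (Fin 2) (ResidueField A), IsRed (ev x) Q := by
  have := hx 1
  rwa [map_one] at this

theorem topCoeff_add {x y : V} (hx : x ∈ integralPart A ρ ev) (hy : y ∈ integralPart A ρ ev) :
    topCoeff A ev n (x + y) = topCoeff A ev n x + topCoeff A ev n y := by
  obtain ⟨Q, h1⟩ := exists_isRed hx
  obtain ⟨Q', h2⟩ := exists_isRed hy
  have h3 := h1.add h2
  rw [← map_add] at h3
  rw [topCoeff, topCoeff, topCoeff, h1.redVal_coeff, h2.redVal_coeff, h3.redVal_coeff, coeff_add]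

theorem topCoeff_smul {x : V} (hx : x ∈ integralPart A ρ ev) (a : A) :
    topCoeff A ev n (a • x) = residue A a * topCoeff A ev n x := by
  obtain ⟨Q, h1⟩ := exists_isRed hx
  have h3 := h1.smul a
  rw [← map_smul, algebraMap_smul] at h3
  rw [topCoeff, topCoeff, h1.redVal_coeff, h3.redVal_coeff, coeff_smul, smul_eq_mul]

end

/-- The sum of the `t`-th powers of the slope against the top coefficient, twisted by `E`. -/
def slopeSum (c : ℕ) (ρ : Representation L (GL (Fin 2) ℤ_[p]) V)
    (ev : V →ₗ[L] MvPolynomial (Fin 2) L) (n : ℕ) (E : GL (Fin 2) ℤ_[p] → ResidueField A) (t : ℕ)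
    (x : V) : ResidueField A :=
  cosetSum ((J p c).subgroupOf (J p 1)) fun g : J p 1 =>
    slope ((residue A).comp (algebraMap ℤ_[p] A)) g.1 ^ t * ((E g.1)⁻¹ * topCoeff A ev n (ρ g.1 x))

variable {c : ℕ} {ρ : Representation L (GL (Fin 2) ℤ_[p]) V}
  {ev : V →ₗ[L] MvPolynomial (Fin 2) L} {n : ℕ} {E : GL (Fin 2) ℤ_[p] → ResidueField A}

theorem slopeSum_add (t : ℕ) {x y : V} (hx : x ∈ integralPart A ρ ev)
    (hy : y ∈ integralPart A ρ ev) :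
    slopeSum c ρ ev n E t (x + y) = slopeSum c ρ ev n E t x + slopeSum c ρ ev n E t y := by
  simp only [slopeSum, cosetSum]
  rw [← Finset.sum_add_distrib]
  refine Finset.sum_congr rfl fun q _ => ?_
  rw [map_add, topCoeff_add (apply_mem_integralPart hx _) (apply_mem_integralPart hy _)]
  ring

theorem slopeSum_smul (t : ℕ) {x : V} (hx : x ∈ integralPart A ρ ev) (a : A) :
    slopeSum c ρ ev n E t (a • x) = residue A a * slopeSum c ρ ev n E t x := by
  simp only [slopeSum, cosetSum]
  rw [Finset.mul_sum]
  refine Finset.sum_congr rfl fun q _ => ?_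
  rw [← algebraMap_smul L a x, map_smul, algebraMap_smul,
    topCoeff_smul (apply_mem_integralPart hx _)]
  ring

theorem slopeSum_zero (t : ℕ) : slopeSum c ρ ev n E t 0 = 0 := by
  have h := slopeSum_smul (c := c) (n := n) (E := E) t
    ((integralPart A ρ ev).zero_mem) (0 : A)
  rwa [smul_zero, map_zero, zero_mul] at h

theorem slopeSum_sum {ι : Type*} (t : ℕ) (s : Finset ι) (y : ι → V)
    (hy : ∀ i ∈ s, y i ∈ integralPart A ρ ev) :
    slopeSum c ρ ev n E t (∑ i ∈ s, y i) = ∑ i ∈ s, slopeSum c ρ ev n E t (y i) := by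
  classical
  induction s using Finset.induction_on with
  | empty => rw [Finset.sum_empty, Finset.sum_empty, slopeSum_zero]
  | insert i s hi ih =>
    rw [Finset.sum_insert hi, Finset.sum_insert hi,
      slopeSum_add t (hy i (Finset.mem_insert_self i s))
        ((integralPart A ρ ev).sum_mem fun j hj => hy j (Finset.mem_insert_of_mem hj)),
      ih fun j hj => hy j (Finset.mem_insert_of_mem hj)]

variable {χ : GL (Fin 2) ℤ_[p] → A}
  (hev : ∀ h ∈ J p c, ∀ x, ev (ρ h x) = algebraMap A L (χ h) •
      substGL L (Matrix.GeneralLinearGroup.map (algebraMap ℤ_[p] L) h) (ev x))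
  (hE : ∀ h ∈ J p c, E h = residue A (χ h) * residue A (algebraMap ℤ_[p] A (h.val 1 1)) ^ n)
  (hEmul : ∀ g ∈ J p 1, ∀ h ∈ J p 1, E (g * h) = E g * E h) (hE0 : ∀ g ∈ J p 1, E g ≠ 0)

include hev hE in
theorem topCoeff_apply_of_mem_J (hc : 1 ≤ c) {x : V} (hx : x ∈ integralPart A ρ ev)
    {h : GL (Fin 2) ℤ_[p]} (hh : h ∈ J p c) :
    topCoeff A ev n (ρ h x) = E h * topCoeff A ev n x := by
  obtain ⟨Q, h1⟩ := exists_isRed hx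
  have h3 := (h1.substGL h).smul (χ h)
  rw [← hev h hh] at h3
  rw [topCoeff, topCoeff, h1.redVal_coeff, h3.redVal_coeff, coeff_smul, smul_eq_mul,
    coeff_single_one_substGL n Q (resHom_eq_zero_of_mem_J (J_le_J hc hh)), hE h hh, ← mul_assoc]
  rfl

include hev hE hEmul hE0 in
theorem slope_topCoeff_invariant (hc : 2 ≤ c) {x : V} (hx : x ∈ integralPart A ρ ev)
    (f : ResidueField A → ResidueField A) :
    ∀ h ∈ (J p c).subgroupOf (J p 1), ∀ g : J p 1,
      f (slope ((residue A).comp (algebraMap ℤ_[p] A)) (h * g).1) *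
        ((E (h * g).1)⁻¹ * topCoeff A ev n (ρ (h * g).1 x)) =
      f (slope ((residue A).comp (algebraMap ℤ_[p] A)) g.1) *
        ((E g.1)⁻¹ * topCoeff A ev n (ρ g.1 x)) := by
  intro h hh g
  have hh' : h.1 ∈ J p c := hh
  have h0 := hE0 _ h.2
  have h1 := hE0 _ g.2
  rw [Subgroup.coe_mul, slope_mul_of_mem_J _ hc g.2 hh', map_mul, Module.End.mul_apply,
    topCoeff_apply_of_mem_J hev hE (by omega) (apply_mem_integralPart hx _) hh',
    hEmul _ h.2 _ g.2]
  field_simp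

-- After reindexing by `h`, the `t`-th power of an affine function of the slope is expanded by the
-- binomial theorem. The lower moments vanish by `hlow`, leaving the leading term with factor
-- `(d/a)^t`.
include hev hE hEmul hE0 in
theorem slopeSum_apply (hc : 2 ≤ c) (t : ℕ) {x : V} (hx : x ∈ integralPart A ρ ev)
    {h : GL (Fin 2) ℤ_[p]} (hh : h ∈ J p 1) (hlow : ∀ s < t, slopeSum c ρ ev n E s x = 0) :
    slopeSum c ρ ev n E t (ρ h x) = E h * ((residue A (algebraMap ℤ_[p] A (h.val 1 1)) /
      residue A (algebraMap ℤ_[p] A (h.val 0 0))) ^ t) * slopeSum c ρ ev n E t x := by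
  set r := (residue A).comp (algebraMap ℤ_[p] A) with hr
  set α : ResidueField A := r (h.val 1 1) / r (h.val 0 0) with hα
  set β : ResidueField A := -(r (divP (h.val 1 0)) / r (h.val 0 0)) with hβ
  have h1 := cosetSum_mul_right (H := (J p c).subgroupOf (J p 1))
    (φ := fun g : J p 1 =>
      (α * slope r g.1 + β) ^ t * ((E g.1)⁻¹ * topCoeff A ev n (ρ g.1 x)))
    (slope_topCoeff_invariant hev hE hEmul hE0 hc hx (fun z => (α * z + β) ^ t)) ⟨h, hh⟩
  have h2 : slopeSum c ρ ev n E t (ρ h x) = E h * cosetSum ((J p c).subgroupOf (J p 1))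
      (fun g : J p 1 => (α * slope r g.1 + β) ^ t * ((E g.1)⁻¹ * topCoeff A ev n (ρ g.1 x))) := by
    rw [← h1]
    simp only [slopeSum, cosetSum]
    rw [Finset.mul_sum]
    refine Finset.sum_congr rfl fun q _ => ?_
    have h3 := hE0 _ hh
    have h4 := hE0 _ (q.out⁻¹).2
    have h6 : slope r (q.out⁻¹).1 = α * slope r ((q.out⁻¹).1 * h) + β := by
      rw [slope_mul r (q.out⁻¹).2 hh, sub_eq_add_neg]
    rw [Subgroup.coe_mul, map_mul ρ, Module.End.mul_apply, hEmul _ (q.out⁻¹).2 _ hh, h6]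
    generalize (α * slope r ((q.out⁻¹).1 * h) + β) ^ t = Z
    field_simp
  have h5 : cosetSum ((J p c).subgroupOf (J p 1))
      (fun g : J p 1 => (α * slope r g.1 + β) ^ t * ((E g.1)⁻¹ * topCoeff A ev n (ρ g.1 x))) =
      ∑ s ∈ Finset.range (t + 1), α ^ s * β ^ (t - s) * (t.choose s : ResidueField A) *
        slopeSum c ρ ev n E s x := by
    simp only [slopeSum, cosetSum, Finset.mul_sum]
    rw [Finset.sum_comm]
    refine Finset.sum_congr rfl fun q _ => ?_
    rw [add_pow, Finset.sum_mul]
    refine Finset.sum_congr rfl fun s _ => ?_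
    rw [mul_pow]
    ring
  rw [h2, h5, Finset.sum_range_succ, Finset.sum_eq_zero]
  · simp [hα, hr, mul_assoc]
  · intro s hs
    rw [hlow s (Finset.mem_range.1 hs), mul_zero]

theorem slopeSum_eq_zero {x : V} (t : ℕ) (hx : ∀ g ∈ J p 1, topCoeff A ev n (ρ g x) = 0) :
    slopeSum c ρ ev n E t x = 0 := by
  refine Finset.sum_eq_zero fun q _ => ?_
  beta_reduce
  rw [hx _ (q.out⁻¹).2, mul_zero, mul_zero]

-- Since `x` is supported on `J p c`, its translate is supported on the single coset of `lowerP p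
-- y`, where the slope is `y`.
include hev hE hEmul hE0 in
theorem slopeSum_lowerP (hc : 2 ≤ c) (hE1 : ∀ y : ℤ_[p], E (lowerP p y) = 1) (t : ℕ) {x : V}
    (hx : x ∈ integralPart A ρ ev) (hx1 : topCoeff A ev n x = 1)
    (hsupp : ∀ g, g ∉ J p c → topCoeff A ev n (ρ g x) = 0) (y : ℤ_[p]) :
    slopeSum c ρ ev n E t (ρ (lowerP p y)⁻¹ x) = residue A (algebraMap ℤ_[p] A y) ^ t := by
  set r := (residue A).comp (algebraMap ℤ_[p] A) with hr
  have h1 := cosetSum_eq_of_support (H := (J p c).subgroupOf (J p 1))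
    (φ := fun g : J p 1 => slope r g.1 ^ t *
      ((E g.1)⁻¹ * topCoeff A ev n (ρ g.1 (ρ (lowerP p y)⁻¹ x))))
    (slope_topCoeff_invariant hev hE hEmul hE0 hc (apply_mem_integralPart hx _)
      (fun z => z ^ t)) ({()} : Finset Unit) (fun _ => ⟨lowerP p y, lowerP_mem_J y⟩)
    (fun _ _ _ _ _ => rfl) (fun g hg => by
      have h2 : g.1 * (lowerP p y)⁻¹ ∉ J p c := hg () (by simp)
      rw [← Module.End.mul_apply, ← map_mul, hsupp _ h2, mul_zero, mul_zero])
  refine h1.trans ?_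
  rw [Finset.sum_singleton, ← Module.End.mul_apply, ← map_mul, mul_inv_cancel, map_one,
    Module.End.one_apply, hx1, hE1, inv_one, one_mul, mul_one, slope_lowerP]
  rfl

/-- Criterion for conductor at least two: all twists of the Iwahori eigencharacter by powers of the
quotient of the diagonal characters occur. -/
theorem isSubquotient_of_slope [IsNoetherianRing A] {ϖ : A}
    (hϖ : maximalIdeal A = Ideal.span {ϖ})
    (hϖ0 : algebraMap A L ϖ ≠ 0) (M : Submodule A V)
    (hfg : M.FG) (hden : ∀ x : V, ∃ b : ℕ, ϖ ^ b • x ∈ M) (hM : IsStable ρ M)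
    (σ : Representation (ResidueField A) (GL (Fin 2) ℤ_[p]) W) (hσ : σ.IsIrreducible)
    (hc : 2 ≤ c)
    (hev : ∀ h ∈ J p c, ∀ x, ev (ρ h x) = algebraMap A L (χ h) •
      substGL L (Matrix.GeneralLinearGroup.map (algebraMap ℤ_[p] L) h) (ev x))
    (hE : ∀ h ∈ J p c, E h = residue A (χ h) * residue A (algebraMap ℤ_[p] A (h.val 1 1)) ^ n)
    (hEmul : ∀ g ∈ J p 1, ∀ h ∈ J p 1, E (g * h) = E g * E h) (hE0 : ∀ g ∈ J p 1, E g ≠ 0)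
    (hE1 : ∀ y : ℤ_[p], E (lowerP p y) = 1) {i : ℕ} (hi : i ≤ p - 1) (v : W) (hv0 : v ≠ 0)
    (hv : ∀ h ∈ J p 1, σ h v = (E h * (residue A (algebraMap ℤ_[p] A (h.val 1 1)) /
      residue A (algebraMap ℤ_[p] A (h.val 0 0))) ^ i) • v)
    (x : V) (hx : x ∈ integralPart A ρ ev) (hx1 : topCoeff A ev n x = 1)
    (hsupp : ∀ g, g ∉ J p c → topCoeff A ev n (ρ g x) = 0) :
    IsSubquotient σ (baseChangeRep (ResidueField A) (latticeRep ρ M hM)) := by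
  have := finite_quotient_J p 1
  let N : Submodule A V :=
    { carrier := {x | x ∈ integralPart A ρ ev ∧
        ∀ g, ∀ t < i, slopeSum c ρ ev n E t (ρ g x) = 0}
      zero_mem' := ⟨Submodule.zero_mem _, fun g t _ => by rw [map_zero, slopeSum_zero]⟩
      add_mem' := fun {x y} hx hy => ⟨Submodule.add_mem _ hx.1 hy.1, fun g t ht => by
        rw [map_add, slopeSum_add t (apply_mem_integralPart hx.1 g)
          (apply_mem_integralPart hy.1 g), hx.2 g t ht, hy.2 g t ht, add_zero]⟩
      smul_mem' := fun a x hx => ⟨Submodule.smul_mem _ a hx.1, fun g t ht => by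
        rw [← algebraMap_smul L a x, map_smul, algebraMap_smul,
          slopeSum_smul t (apply_mem_integralPart hx.1 g), hx.2 g t ht, mul_zero]⟩ }
  have hN0 : ∀ x ∈ N, ∀ t < i, slopeSum c ρ ev n E t x = 0 := fun x hx t ht => by
    have := hx.2 1 t ht
    rwa [map_one, Module.End.one_apply] at this
  -- The weights `y^(p-1-i)` make the `t`-th moment of `z` the power sum of exponent `p - 1 - i +
  -- t`: zero for `t < i`, nonzero for `t = i`.
  let z : V := ∑ y ∈ Finset.range p, (y : A) ^ (p - 1 - i) • ρ (lowerP p (y : ℤ_[p]))⁻¹ x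
  have hz : z ∈ integralPart A ρ ev := Submodule.sum_mem _ fun y _ =>
    Submodule.smul_mem _ _ (apply_mem_integralPart hx _)
  have hzsum : ∀ t, slopeSum c ρ ev n E t z =
      ∑ y ∈ Finset.range p, (y : ResidueField A) ^ (p - 1 - i + t) := by
    intro t
    rw [slopeSum_sum t _ _ fun y _ => Submodule.smul_mem _ _ (apply_mem_integralPart hx _)]
    refine Finset.sum_congr rfl fun y _ => ?_
    rw [slopeSum_smul t (apply_mem_integralPart hx _),
      slopeSum_lowerP hev hE hEmul hE0 hc hE1 t hx hx1 hsupp]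
    simp [pow_add]
  have hzlow : ∀ t < i, slopeSum c ρ ev n E t z = 0 := fun t ht => by
    rw [hzsum, sum_range_pow_eq_zero (by omega)]
  have hzsupp : ∀ t, ∀ g, g ∉ J p 1 → slopeSum c ρ ev n E t (ρ g z) = 0 := by
    intro t g hg
    have h1 : ρ g z = ∑ y ∈ Finset.range p,
        (y : A) ^ (p - 1 - i) • ρ (g * (lowerP p (y : ℤ_[p]))⁻¹) x := by
      simp only [z]
      rw [map_sum]
      refine Finset.sum_congr rfl fun y _ => ?_
      rw [map_mul, Module.End.mul_apply,
        ← algebraMap_smul L ((y : A) ^ (p - 1 - i)) (ρ (lowerP p (y : ℤ_[p]))⁻¹ x), map_smul,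
        algebraMap_smul]
    rw [h1, slopeSum_sum t _ _ fun y _ => Submodule.smul_mem _ _ (apply_mem_integralPart hx _)]
    refine Finset.sum_eq_zero fun y _ => ?_
    rw [slopeSum_smul t (apply_mem_integralPart hx _), slopeSum_eq_zero t, mul_zero]
    intro g' hg'
    rw [← Module.End.mul_apply, ← map_mul]
    refine hsupp _ fun hmem => hg ?_
    have h2 := J_le_J (by omega) hmem
    rw [← mul_assoc] at h2
    have h3 := ((J p 1).mul_mem_cancel_right ((J p 1).inv_mem (lowerP_mem_J (y : ℤ_[p])))).1 h2
    exact ((J p 1).mul_mem_cancel_left hg').1 h3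
  refine isSubquotient_of_eigenfunctional hϖ hϖ0 ρ M hfg hden hM σ hσ (J p 1) _ v hv0 hv N ?_
    (slopeSum c ρ ev n E i) ?_ ?_ ?_ z ⟨hz, fun g t ht => ?_⟩ ?_ (hzsupp i)
  · exact fun g x hx => ⟨apply_mem_integralPart hx.1 g, fun g' t ht => by
      rw [← Module.End.mul_apply, ← map_mul, hx.2 _ t ht]⟩
  · exact fun x hx y hy => slopeSum_add i hx.1 hy.1
  · exact fun a x hx => slopeSum_smul i hx.1 a
  · exact fun h hh x hx => slopeSum_apply hev hE hEmul hE0 hc i hx.1 hh (hN0 x hx)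
  · by_cases hg : g ∈ J p 1
    · rw [slopeSum_apply hev hE hEmul hE0 hc t hz hg fun s hs => hzlow s (hs.trans ht),
        hzlow t ht, mul_zero]
    · exact hzsupp t g hg
  · rw [hzsum, Nat.sub_add_cancel hi]
    exact sum_range_pow_ne_zero

end SlopeCriterion

theorem exists_pow_smul_mem {A L : Type*} [CommRing A] [Field L] [Algebra A L] {ϖ : A}
    (hϖ : ∀ x : L, ∃ b : ℕ, ∃ a : A, algebraMap A L ϖ ^ b * x = algebraMap A L a)
    {V : Type*} [AddCommGroup V] [Module L V] [Module A V]
    [IsScalarTower A L V] {M : Submodule A V}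
    (hM : Submodule.span L (M : Set V) = ⊤) (x : V) : ∃ b : ℕ, ϖ ^ b • x ∈ M := by
  have hx : x ∈ Submodule.span L (M : Set V) := by rw [hM]; trivial
  induction hx using Submodule.span_induction with
  | mem x hx => exact ⟨0, by rwa [pow_zero, one_smul]⟩
  | zero => exact ⟨0, by rw [smul_zero]; exact M.zero_mem⟩
  | add x y _ _ hx hy =>
    obtain ⟨b, hb⟩ := hx
    obtain ⟨b', hb'⟩ := hy
    refine ⟨b + b', ?_⟩
    rw [smul_add]
    refine M.add_mem ?_ ?_
    · rw [add_comm, pow_add, mul_smul]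
      exact M.smul_mem _ hb
    · rw [pow_add, mul_smul]
      exact M.smul_mem _ hb'
  | smul a x _ hx =>
    obtain ⟨b, hb⟩ := hx
    obtain ⟨b', c, hc⟩ := hϖ a
    refine ⟨b' + b, ?_⟩
    have h1 : ϖ ^ (b' + b) • a • x = c • ϖ ^ b • x := by
      rw [← algebraMap_smul L (ϖ ^ (b' + b)) (a • x), ← algebraMap_smul L c,
        ← algebraMap_smul L (ϖ ^ b) x, smul_smul, smul_smul, map_pow, map_pow, pow_add, ← hc]
      congr 1
      ring
    rw [h1]
    exact M.smul_mem _ hb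

/-! ### The ring of integers, reduced characters and the functional on `τ(θ₁, θ₂)`. -/

section RingOfInt

open IsLocalRing

variable (p : ℕ) [Fact p.Prime] (L : Type*) [Field L] [Algebra ℚ_[p] L] [FiniteDimensional ℚ_[p] L]
  [Algebra ℤ_[p] L] [IsScalarTower ℤ_[p] ℚ_[p] L]

include L in
theorem faithfulSMul_ringOfInt : FaithfulSMul ℤ_[p] (ringOfInt p L) := by
  have : FaithfulSMul ℤ_[p] L := FaithfulSMul.trans ℤ_[p] ℚ_[p] L
  infer_instance

instance ringOfInt_isDiscreteValuationRing : IsDiscreteValuationRing (ringOfInt p L) := by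
  have := faithfulSMul_ringOfInt p L
  have h1 : IsDedekindDomain (ringOfInt p L) := integralClosure.isDedekindDomain ℤ_[p] ℚ_[p] L
  have h2 : ¬ IsField (ringOfInt p L) := fun h =>
    IsDiscreteValuationRing.not_isField ℤ_[p] ((Algebra.IsIntegral.isField_iff_isField
      (FaithfulSMul.algebraMap_injective ℤ_[p] (ringOfInt p L))).2 h)
  exact ((IsDiscreteValuationRing.TFAE _ h2).out 0 2).2 h1

instance resField_charP : CharP (resField p L) p := by
  have := faithfulSMul_ringOfInt p L
  have h1 : (p : resField p L) = 0 := by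
    have h2 : (algebraMap ℤ_[p] (ringOfInt p L) p) ∈ maximalIdeal (ringOfInt p L) := by
      refine map_nonunit _ _ ?_
      rw [PadicInt.maximalIdeal_eq_span_p]
      exact Ideal.mem_span_singleton_self _
    rw [← residue_eq_zero_iff, map_natCast, map_natCast] at h2
    exact h2
  exact (CharP.charP_iff_prime_eq_zero Fact.out).2 h1

theorem exists_uniformizer : ∃ ϖ : ringOfInt p L,
    maximalIdeal (ringOfInt p L) = Ideal.span {ϖ} ∧ algebraMap (ringOfInt p L) L ϖ ≠ 0 ∧
      ∀ x : L, ∃ b : ℕ, ∃ a : ringOfInt p L,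
        algebraMap (ringOfInt p L) L ϖ ^ b * x = algebraMap (ringOfInt p L) L a := by
  obtain ⟨ϖ, hϖ⟩ := IsDiscreteValuationRing.exists_irreducible (ringOfInt p L)
  have : IsFractionRing (ringOfInt p L) L :=
    integralClosure.isFractionRing_of_finite_extension ℚ_[p] L
  have hinj := FaithfulSMul.algebraMap_injective (ringOfInt p L) L
  refine ⟨ϖ, hϖ.maximalIdeal_eq, (map_ne_zero_iff _ hinj).2 hϖ.ne_zero, fun x => ?_⟩
  obtain ⟨y, s, hs, rfl⟩ := IsFractionRing.div_surjective (A := ringOfInt p L) x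
  obtain ⟨b, u, hu⟩ := IsDiscreteValuationRing.eq_unit_mul_pow_irreducible
    (nonZeroDivisors.ne_zero hs) hϖ
  refine ⟨b, ((u⁻¹ : (ringOfInt p L)ˣ) : ringOfInt p L) * y, ?_⟩
  have h1 : algebraMap (ringOfInt p L) L s ≠ 0 :=
    (map_ne_zero_iff _ hinj).2 (nonZeroDivisors.ne_zero hs)
  rw [mul_div_assoc', div_eq_iff h1, ← map_pow, ← map_mul, ← map_mul, hu]
  congr 1
  linear_combination (-(y * ϖ ^ b)) * u.inv_mul

variable {p L}

/-! ### Smooth characters modulo the maximal ideal -/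

theorem val_reductionChar {θ : ℤ_[p]ˣ →* Lˣ} (hθ : IsSmoothChar θ) (u : ℤ_[p]ˣ) :
    (reductionChar θ hθ u : resField p L) =
      residue (ringOfInt p L) (integralChar θ hθ u) := rfl

/-- On `1 + pℤ_p` a smooth character has `p`-power order, and a field of characteristic `p` has no
nontrivial `p`-power roots of unity. -/
theorem reductionChar_eq_one {θ : ℤ_[p]ˣ →* Lˣ} (hθ : IsSmoothChar θ) {u : ℤ_[p]ˣ}
    (hu : u ∈ oneUnits p) : reductionChar θ hθ u = 1 := by
  obtain ⟨c, -, hc⟩ := hθ.exists_trivialOn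
  have h1 : θ (u ^ p ^ c) = 1 := by
    refine hc _ ((pow_dvd_pow (p : ℤ_[p]) (Nat.le_succ c)).trans ?_)
    have := dvd_sub_pow_of_dvd_sub (mem_oneUnits.1 hu) c
    rwa [one_pow] at this
  have h2 : reductionChar θ hθ (u ^ p ^ c) = 1 := by
    refine Units.ext ?_
    have h3 : integralChar θ hθ (u ^ p ^ c) = 1 := Subtype.ext (congrArg Units.val h1)
    rw [val_reductionChar, h3, map_one, Units.val_one]
  rw [map_pow, Units.ext_iff, Units.val_pow_eq_pow_val, Units.val_one] at h2
  refine Units.ext (sub_eq_zero.1 ?_)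
  rw [Units.val_one]
  refine eq_zero_of_pow_eq_zero (n := p ^ c) ?_
  rw [sub_pow_char_pow, h2, one_pow, sub_self]

theorem reductionChar_congr {θ : ℤ_[p]ˣ →* Lˣ} (hθ : IsSmoothChar θ) {u v : ℤ_[p]ˣ}
    (h : (p : ℤ_[p]) ∣ (u : ℤ_[p]) - v) : reductionChar θ hθ u = reductionChar θ hθ v := by
  rw [← mul_inv_eq_one, ← map_inv, ← map_mul]
  refine reductionChar_eq_one hθ (mem_oneUnits.2 ?_)
  have h1 : ((u * v⁻¹ : ℤ_[p]ˣ) : ℤ_[p]) - 1 = ((u : ℤ_[p]) - v) * (v⁻¹ : ℤ_[p]ˣ) := by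
    rw [sub_mul, Units.mul_inv, Units.val_mul]
  rw [h1]
  exact h.mul_right _

theorem reductionChar_div {θ₁ θ₂ : ℤ_[p]ˣ →* Lˣ} (h₁ : IsSmoothChar θ₁) (h₂ : IsSmoothChar θ₂)
    (u : ℤ_[p]ˣ) :
    reductionChar (θ₁ / θ₂) (h₁.div h₂) u = reductionChar θ₁ h₁ u / reductionChar θ₂ h₂ u := by
  rw [eq_div_iff_mul_eq']
  refine Units.ext ?_
  rw [Units.val_mul, val_reductionChar, val_reductionChar, val_reductionChar, ← map_mul]
  congr 1
  refine Subtype.ext ?_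
  change ((θ₁ / θ₂) u : L) * (θ₂ u : Lˣ) = θ₁ u
  rw [← Units.val_mul, MonoidHom.div_apply, div_mul_cancel]

theorem det_sub_dvd {g : GL (Fin 2) ℤ_[p]} (hg : g ∈ J p 1) {a d : ℤ_[p]ˣ}
    (ha : (a : ℤ_[p]) = g.val 0 0) (hd : (d : ℤ_[p]) = g.val 1 1) :
    (p : ℤ_[p]) ∣ (Matrix.GeneralLinearGroup.det g : ℤ_[p]) - ((a * d : ℤ_[p]ˣ) : ℤ_[p]) := by
  have h1 : ((Matrix.GeneralLinearGroup.det g : ℤ_[p]ˣ) : ℤ_[p]) =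
      g.val 0 0 * g.val 1 1 - g.val 0 1 * g.val 1 0 := Matrix.det_fin_two _
  rw [h1, Units.val_mul, ha, hd]
  obtain ⟨y, hy⟩ := dvd_of_mem_J_one hg
  exact ⟨-(g.val 0 1 * y), by rw [hy]; ring⟩

/-! ### The functional "evaluation at `1`" on `τ(θ₁, θ₂)` -/

open scoped Classical in
/-- The character of `J_c` with values in `A`, extended by zero. -/
def integralTypeChar {θ₁ θ₂ : ℤ_[p]ˣ →* Lˣ} (h₁ : IsSmoothChar θ₁) (h₂ : IsSmoothChar θ₂) (c : ℕ)
    (hc : 1 ≤ c) (g : GL (Fin 2) ℤ_[p]) : ringOfInt p L :=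
  if hg : g ∈ J p c then integralChar (θ₁ / θ₂) (h₁.div h₂) (upperLeft hc ⟨g, hg⟩) *
    integralChar θ₂ h₂ (Matrix.GeneralLinearGroup.det g) else 0

theorem algebraMap_integralTypeChar {θ₁ θ₂ : ℤ_[p]ˣ →* Lˣ} (h₁ : IsSmoothChar θ₁)
    (h₂ : IsSmoothChar θ₂) {c : ℕ} (hc : 1 ≤ c) (h : TrivialOn (θ₁ / θ₂) c)
    {g : GL (Fin 2) ℤ_[p]} (hg : g ∈ J p c) :
    algebraMap (ringOfInt p L) L (integralTypeChar h₁ h₂ c hc g) =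
      (typeChar θ₁ θ₂ c hc h ⟨g, hg⟩ : Lˣ) := by
  rw [integralTypeChar, dif_pos hg]
  rfl

theorem residue_integralTypeChar {θ₁ θ₂ : ℤ_[p]ˣ →* Lˣ} (h₁ : IsSmoothChar θ₁)
    (h₂ : IsSmoothChar θ₂) {c : ℕ} (hc : 1 ≤ c) {g : GL (Fin 2) ℤ_[p]} (hg : g ∈ J p c)
    {a d : ℤ_[p]ˣ} (ha : (a : ℤ_[p]) = g.val 0 0) (hd : (d : ℤ_[p]) = g.val 1 1) :
    residue (ringOfInt p L) (integralTypeChar h₁ h₂ c hc g) =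
      ((reductionChar θ₁ h₁ a * reductionChar θ₂ h₂ d : (resField p L)ˣ) : resField p L) := by
  have h3 : upperLeft hc ⟨g, hg⟩ = a := Units.ext ha.symm
  rw [integralTypeChar, dif_pos hg, map_mul, ← val_reductionChar, ← val_reductionChar, h3,
    ← Units.val_mul, reductionChar_div h₁ h₂, reductionChar_congr h₂ (det_sub_dvd (J_le_J hc hg) ha hd),
    map_mul, ← mul_assoc, div_mul_cancel]

/-- The functional is evaluation at `1`. The vector is the inducing character extended by zero, so
one function serves both as eigencharacter and as test vector supported on `J p c`. -/
theorem exists_functional_tau_of_ne {θ₁ θ₂ : ℤ_[p]ˣ →* Lˣ} (h₁ : IsSmoothChar θ₁)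
    (h₂ : IsSmoothChar θ₂) (hne : θ₁ ≠ θ₂) {c : ℕ} (hc : conductor (θ₁ / θ₂) = c) (hc1 : 1 ≤ c) :
    ∃ (ev : (tau θ₁ θ₂ h₁ h₂).V →ₗ[L] L) (x : (tau θ₁ θ₂ h₁ h₂).V),
      (∀ h ∈ J p c, ∀ y, ev ((tau θ₁ θ₂ h₁ h₂).ρ h y) =
        algebraMap (ringOfInt p L) L (integralTypeChar h₁ h₂ c hc1 h) * ev y) ∧
      ∀ g, ev ((tau θ₁ θ₂ h₁ h₂).ρ g x) =
        algebraMap (ringOfInt p L) L (integralTypeChar h₁ h₂ c hc1 g) := by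
  classical
  subst hc
  have hspec := conductor_spec (h₁.div h₂)
  set ψ := typeChar θ₁ θ₂ _ hspec.1 hspec.2 with hψ
  have htau : tau θ₁ θ₂ h₁ h₂ =
      Rep.of (Representation.coind (J p (conductor (θ₁ / θ₂))).subtype (charRep ψ)) := if_neg hne
  rw [htau]
  let ev : Representation.coindV (J p (conductor (θ₁ / θ₂))).subtype (charRep ψ) →ₗ[L] L :=
    (LinearMap.proj (1 : GL (Fin 2) ℤ_[p])).comp (Submodule.subtype _)
  let f : GL (Fin 2) ℤ_[p] → L := fun g =>
    algebraMap (ringOfInt p L) L (integralTypeChar h₁ h₂ _ hspec.1 g)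
  have hf : f ∈ Representation.coindV (J p (conductor (θ₁ / θ₂))).subtype (charRep ψ) := by
    intro h g
    change f (h.1 * g) = (ψ h : L) • f g
    by_cases hg : g ∈ J p (conductor (θ₁ / θ₂))
    · have hhg := Subgroup.mul_mem _ h.2 hg
      simp only [f]
      rw [algebraMap_integralTypeChar h₁ h₂ hspec.1 hspec.2 hg,
        algebraMap_integralTypeChar h₁ h₂ hspec.1 hspec.2 hhg, smul_eq_mul, ← Units.val_mul,
        ← map_mul]
      rfl
    · have hhg : h.1 * g ∉ J p (conductor (θ₁ / θ₂)) := fun hmem =>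
        hg ((Subgroup.mul_mem_cancel_left _ h.2).1 hmem)
      simp only [f, integralTypeChar]
      rw [dif_neg hg, dif_neg hhg, map_zero, smul_zero]
  refine ⟨ev, ⟨f, hf⟩, fun h hh y => ?_, fun g => ?_⟩
  · rw [algebraMap_integralTypeChar h₁ h₂ hspec.1 hspec.2 hh]
    change y.1 (1 * h) = (ψ ⟨h, hh⟩ : L) * y.1 1
    have h3 : y.1 (h * 1) = (ψ ⟨h, hh⟩ : L) • y.1 1 := y.2 ⟨h, hh⟩ 1
    rw [one_mul, ← smul_eq_mul, ← h3, mul_one]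
  · change f (1 * g) = _
    rw [one_mul]

theorem exists_functional_tau_self {θ : ℤ_[p]ˣ →* Lˣ} (h₁ h₂ : IsSmoothChar θ) :
    ∃ (ev : (tau θ θ h₁ h₂).V →ₗ[L] L) (x : (tau θ θ h₁ h₂).V),
      (∀ g y, ev ((tau θ θ h₁ h₂).ρ g y) = algebraMap (ringOfInt p L) L
        (integralChar θ h₁ (Matrix.GeneralLinearGroup.det g)) * ev y) ∧ ev x = 1 := by
  have htau : tau θ θ h₁ h₂ =
      Rep.of (charRep (θ.comp Matrix.GeneralLinearGroup.det)) := if_pos rfl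
  rw [htau]
  exact ⟨LinearMap.id, (1 : L), fun g y => rfl, rfl⟩

end RingOfInt

/-! ### Evaluation on the tensor product with the symmetric power. -/

section TensorEval

variable {p : ℕ} [Fact p.Prime] {L : Type*} [Field L] [Algebra ℤ_[p] L]
  {X : Type*} [AddCommGroup X] [Module L X]

/-- The map `X ⊗ Sym^n → L[X₀, X₁]` induced by a functional on `X`. -/
def tensorEval (ev : X →ₗ[L] L) (n : ℕ) : X ⊗[L] SymPow L n →ₗ[L] MvPolynomial (Fin 2) L :=
  (SymPow L n).subtype ∘ₗ (TensorProduct.lid L (SymPow L n)).toLinearMap ∘ₗ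
    ev.rTensor (SymPow L n)

theorem tensorEval_tmul (ev : X →ₗ[L] L) (n : ℕ) (x : X) (P : SymPow L n) :
    tensorEval ev n (x ⊗ₜ P) = ev x • (P : MvPolynomial (Fin 2) L) := by
  simp [tensorEval]

theorem tensorEval_apply (ev : X →ₗ[L] L) (n : ℕ) (ρ : Representation L (GL (Fin 2) ℤ_[p]) X)
    {h : GL (Fin 2) ℤ_[p]} {s : L} (hs : ∀ y, ev (ρ h y) = s * ev y) (z : X ⊗[L] SymPow L n) :
    tensorEval ev n (ρ.tprod (symRepK p L n) h z) = s •
      substGL L (Matrix.GeneralLinearGroup.map (algebraMap ℤ_[p] L) h) (tensorEval ev n z) := by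
  induction z using TensorProduct.induction_on with
  | zero => simp
  | add x y hx hy => rw [map_add, map_add, hx, hy, map_add, map_add, smul_add]
  | tmul x P =>
    rw [Representation.tprod_apply, TensorProduct.map_tmul, tensorEval_tmul, tensorEval_tmul, hs,
      map_smul, smul_smul]
    rfl

end TensorEval

/-! ### Dickson invariants and test polynomials. -/

section TestPolynomials

open MvPolynomial

theorem X_zero_pow_dvd_substGL' {F : Type*} [Field F] {g : GL (Fin 2) F} (hg : g.val 1 0 = 0)
    (j : ℕ) (P : MvPolynomial (Fin 2) F) : X 0 ^ j ∣ substGL F g (X 0 ^ j * P) := by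
  have h1 : substGL F g (X 0) = C (g.val 0 0) * X 0 := by simp [substGL, hg]
  rw [map_mul, map_pow, h1, mul_pow]
  exact (dvd_mul_left _ _).mul_right _

/-- The Dickson invariant `X₀ ^ p X₁ - X₀ X₁ ^ p`. -/
def dickson (R : Type*) [CommRing R] (p : ℕ) : MvPolynomial (Fin 2) R :=
  X 0 ^ p * X 1 - X 0 * X 1 ^ p

/-- A polynomial vanishing on the `𝔽_p`-points outside the lines `X₀ = 0`. -/
def linePoly (R : Type*) [CommRing R] (p e : ℕ) : MvPolynomial (Fin 2) R :=
  X 1 ^ e * (X 1 ^ (p - 1) - X 0 ^ (p - 1))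

theorem map_dickson_pow_mul_linePoly {R S : Type*} [CommRing R] [CommRing S] (f : R →+* S)
    (p j e : ℕ) : map f (dickson R p ^ j * linePoly R p e) = dickson S p ^ j * linePoly S p e := by
  simp [dickson, linePoly]

theorem isHomogeneous_dickson_pow_mul_linePoly (R : Type*) [CommRing R] (p j e : ℕ) :
    (dickson R p ^ j * linePoly R p e).IsHomogeneous ((p + 1) * j + (e + (p - 1))) := by
  refine ((IsHomogeneous.sub ?_ ?_).pow j).mul (IsHomogeneous.mul ?_ (IsHomogeneous.sub ?_ ?_))
  · simpa using (isHomogeneous_X_pow (R := R) (0 : Fin 2) p).mul (isHomogeneous_X R 1)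
  · simpa [add_comm] using (isHomogeneous_X R (0 : Fin 2)).mul (isHomogeneous_X_pow 1 p)
  · exact isHomogeneous_X_pow _ _
  · exact isHomogeneous_X_pow _ _
  · exact isHomogeneous_X_pow _ _

variable {p : ℕ} [Fact p.Prime] {F : Type*} [Field F] [CharP F p] (r : ℤ_[p] →+* F)

theorem ringHom_pow_char (x : ℤ_[p]) : r x ^ p = r x := by
  rw [← map_pow, ← sub_eq_zero, ← map_sub, ringHom_eq_zero_iff, ← toZMod_eq_zero_iff, map_sub,
    map_pow, ZMod.pow_card, sub_self]

/-- The reduced matrix entries lie in `𝔽_p`, so `X₀^p` and `X₁^p` transform by the same matrix as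
`X₀` and `X₁`. The Dickson invariant is the determinant of these two pairs. -/
theorem substGL_dickson (g : GL (Fin 2) ℤ_[p]) :
    substGL F (Matrix.GeneralLinearGroup.map r g) (dickson F p) =
      C (r (Matrix.GeneralLinearGroup.det g : ℤ_[p]ˣ)) * dickson F p := by
  have h1 : ((Matrix.GeneralLinearGroup.det g : ℤ_[p]ˣ) : ℤ_[p]) =
      g.val 0 0 * g.val 1 1 - g.val 0 1 * g.val 1 0 := Matrix.det_fin_two _
  have h2 : ∀ j, substGL F (Matrix.GeneralLinearGroup.map r g) (X j) =
      C (r (g.val 0 j)) * X 0 + C (r (g.val 1 j)) * X 1 := by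
    intro j
    simp [substGL]
  have h3 : ∀ j, (substGL F (Matrix.GeneralLinearGroup.map r g) (X j)) ^ p =
      C (r (g.val 0 j)) * X 0 ^ p + C (r (g.val 1 j)) * X 1 ^ p := by
    intro j
    rw [h2, add_pow_char, mul_pow, mul_pow, ← C_pow, ← C_pow, ringHom_pow_char, ringHom_pow_char]
  rw [h1, dickson, map_sub, map_mul, map_mul, map_pow, map_pow, h3, h3, h2, h2]
  simp only [map_sub, map_mul]
  ring

/-- Removing `X₀^j` from the Dickson factor and setting `X₀ = 0` leaves `(-X₁^p)^j` times the value
of `linePoly` at the bottom row of `g`. -/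
theorem coeff_dickson_pow_mul_substGL (g : GL (Fin 2) ℤ_[p]) (j e m : ℕ)
    (hm : m = p * j + (e + (p - 1))) :
    coeff (biExp j m) (dickson F p ^ j *
      substGL F (Matrix.GeneralLinearGroup.map r g) (linePoly F p e)) =
    (-1) ^ j * (r (g.val 1 1) ^ e * (r (g.val 1 1) ^ (p - 1) - r (g.val 1 0) ^ (p - 1))) := by
  have hp : p - 1 ≠ 0 := by have := (Fact.out : p.Prime).two_le; omega
  have h1 : dickson F p = X 0 * (X 0 ^ (p - 1) * X 1 - X 1 ^ p) := by
    have : (X 0 : MvPolynomial (Fin 2) F) ^ p = X 0 * X 0 ^ (p - 1) := by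
      rw [← pow_succ', Nat.sub_add_cancel (Fact.out : p.Prime).one_lt.le]
    rw [dickson, this]
    ring
  rw [h1, mul_pow, mul_assoc, coeff_biExp_X_pow_mul, coeff_single_one]
  have h2 : ∀ i, aeval (![0, Polynomial.X] : Fin 2 → Polynomial F)
      (substGL F (Matrix.GeneralLinearGroup.map r g) (X i)) =
      Polynomial.C (r (g.val 1 i)) * Polynomial.X := by
    intro i
    simp [substGL]
  have h3 : aeval (![0, Polynomial.X] : Fin 2 → Polynomial F)
      ((X 0 ^ (p - 1) * X 1 - X 1 ^ p) ^ j *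
        substGL F (Matrix.GeneralLinearGroup.map r g) (linePoly F p e)) =
      Polynomial.C ((-1) ^ j * (r (g.val 1 1) ^ e *
        (r (g.val 1 1) ^ (p - 1) - r (g.val 1 0) ^ (p - 1)))) * Polynomial.X ^ m := by
    rw [linePoly]
    simp only [map_mul, map_pow, map_sub, h2, aeval_X, Matrix.cons_val_zero, Matrix.cons_val_one,
      zero_pow hp, zero_mul, zero_sub, map_neg, map_one]
    rw [neg_pow, ← pow_mul, hm]
    ring
  rw [h3, Polynomial.coeff_C_mul, Polynomial.coeff_X_pow_self, mul_one]

end TestPolynomials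

/-! ### The three cases according to the conductor. -/

section Cases

open MvPolynomial IsLocalRing

variable {p : ℕ} [Fact p.Prime] {L : Type*} [Field L] [Algebra ℚ_[p] L] [FiniteDimensional ℚ_[p] L]
  [Algebra ℤ_[p] L] [IsScalarTower ℤ_[p] ℚ_[p] L] {θ₁ θ₂ : ℤ_[p]ˣ →* Lˣ}
  {n : ℕ} (T : Rep L (GL (Fin 2) ℤ_[p]))
  (M : Submodule (ringOfInt p L) (T.V ⊗[L] SymPow L n)) (hlat : M.IsLattice L)
  (hM : IsStable (T.ρ.tprod (symRepK p L n)) M)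
  {W : Type*} [AddCommGroup W] [Module (resField p L) W]
  (σ : Representation (resField p L) (GL (Fin 2) ℤ_[p]) W) (hirr : σ.IsIrreducible)

theorem val_omega (u : ℤ_[p]ˣ) : (omega p L u : resField p L) =
    residue (ringOfInt p L) (algebraMap ℤ_[p] (ringOfInt p L) u) := rfl

theorem omega_pow (u : ℤ_[p]ˣ) : omega p L u ^ (p - 1) = 1 := by
  refine Units.ext ?_
  rw [Units.val_pow_eq_pow_val, Units.val_one]
  exact ringHom_unit_pow ((residue (ringOfInt p L)).comp (algebraMap ℤ_[p] (ringOfInt p L))) u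

theorem integralTypeChar_one (h₁ : IsSmoothChar θ₁) (h₂ : IsSmoothChar θ₂) {c : ℕ} (hc : 1 ≤ c) :
    residue (ringOfInt p L) (integralTypeChar h₁ h₂ c hc 1) = 1 := by
  rw [residue_integralTypeChar h₁ h₂ hc (one_mem _) (a := 1) (d := 1) (by simp) (by simp)]
  simp

include hlat hirr in
theorem isSubquotient_of_conductor_one (h₁ : IsSmoothChar θ₁) (h₂ : IsSmoothChar θ₂)
    (ev : T.V →ₗ[L] L) (x : T.V)
    (hev : ∀ h ∈ J p 1, ∀ y, ev (T.ρ h y) =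
      algebraMap (ringOfInt p L) L (integralTypeChar h₁ h₂ 1 le_rfl h) * ev y)
    (hx : ∀ g, ev (T.ρ g x) = algebraMap (ringOfInt p L) L (integralTypeChar h₁ h₂ 1 le_rfl g))
    {j : ℕ} (hj : j ≤ n) (v : W) (hv0 : v ≠ 0)
    (hv : ∀ h ∈ J p 1, ∀ a d : ℤ_[p]ˣ, (a : ℤ_[p]) = h.val 0 0 → (d : ℤ_[p]) = h.val 1 1 →
      σ h v = ((reductionChar θ₁ h₁ a * reductionChar θ₂ h₂ d *
        (omega p L a ^ j * omega p L d ^ (n - j)) : (resField p L)ˣ) : resField p L) • v) :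
    IsSubquotient σ (baseChangeRep (resField p L)
      (latticeRep (T.ρ.tprod (symRepK p L n)) M hM)) := by
  obtain ⟨ϖ, hϖ, hϖ0, hden⟩ := exists_uniformizer p L
  have hP : (X 0 ^ j * X 1 ^ (n - j) : MvPolynomial (Fin 2) L) ∈ SymPow L n := by
    have := (isHomogeneous_X_pow (R := L) (0 : Fin 2) j).mul (isHomogeneous_X_pow 1 (n - j))
    rwa [Nat.add_sub_cancel' hj] at this
  have hPred : IsRed (A := ringOfInt p L) (X 0 ^ j * X 1 ^ (n - j) : MvPolynomial (Fin 2) L)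
      (X 0 ^ j * X 1 ^ (n - j)) := ⟨X 0 ^ j * X 1 ^ (n - j), by simp, by simp⟩
  refine isSubquotient_of_coeff hϖ hϖ0 _ M hlat.fg
    (exists_pow_smul_mem hden hlat.span_eq_top) hM σ hirr (tensorEval ev n)
    (integralTypeChar h₁ h₂ 1 le_rfl) (fun h hh z => tensorEval_apply ev n T.ρ (hev h hh) z)
    j (n - j) v hv0 ?_ (x ⊗ₜ ⟨_, hP⟩)
    (fun g => residue _ (integralTypeChar h₁ h₂ 1 le_rfl g) • substGL _
      (Matrix.GeneralLinearGroup.map ((residue (ringOfInt p L)).comp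
        (algebraMap ℤ_[p] (ringOfInt p L))) g) (X 0 ^ j * X 1 ^ (n - j))) ?_ ?_ ?_ ?_
  · intro h hh
    obtain ⟨⟨a, ha⟩, ⟨d, hd⟩⟩ := isUnit_diag_of_mem_J_one hh
    rw [hv h hh a d ha hd, residue_integralTypeChar h₁ h₂ le_rfl hh ha hd, ← ha, ← hd,
      ← val_omega, ← val_omega]
    simp
  · intro g
    have h3 : tensorEval ev n (T.ρ.tprod (symRepK p L n) g (x ⊗ₜ ⟨_, hP⟩)) =
        algebraMap (ringOfInt p L) L (integralTypeChar h₁ h₂ 1 le_rfl g) •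
        substGL L (Matrix.GeneralLinearGroup.map (algebraMap ℤ_[p] L) g)
          (X 0 ^ j * X 1 ^ (n - j)) := by
      rw [Representation.tprod_apply, TensorProduct.map_tmul, tensorEval_tmul, hx]
      rfl
    rw [h3]
    exact (hPred.substGL g).smul _
  · intro g
    by_cases hg : g ∈ J p 1
    · rw [smul_eq_C_mul]
      exact (X_zero_pow_dvd_substGL' (resHom_eq_zero_of_mem_J hg) j _).mul_left _
    · rw [integralTypeChar, dif_neg hg, map_zero, zero_smul]
      exact dvd_zero _
  · rw [integralTypeChar_one, one_smul, map_one, substGL_one, AlgHom.id_apply,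
      coeff_biExp_X_pow_mul, X_pow_eq_monomial, coeff_monomial, if_pos rfl]
    exact one_ne_zero
  · intro g hg
    rw [integralTypeChar, dif_neg hg, map_zero, zero_smul, coeff_zero]

include hlat hirr in
theorem isSubquotient_of_two_le_conductor (h₁ : IsSmoothChar θ₁) (h₂ : IsSmoothChar θ₂) {c : ℕ}
    (hc : 2 ≤ c) (hc1 : 1 ≤ c) (ev : T.V →ₗ[L] L) (x : T.V)
    (hev : ∀ h ∈ J p c, ∀ y, ev (T.ρ h y) =
      algebraMap (ringOfInt p L) L (integralTypeChar h₁ h₂ c hc1 h) * ev y)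
    (hx : ∀ g, ev (T.ρ g x) = algebraMap (ringOfInt p L) L (integralTypeChar h₁ h₂ c hc1 g))
    {i : ℕ} (hi : i ≤ p - 1) (v : W) (hv0 : v ≠ 0)
    (hv : ∀ h ∈ J p 1, ∀ a d : ℤ_[p]ˣ, (a : ℤ_[p]) = h.val 0 0 → (d : ℤ_[p]) = h.val 1 1 →
      σ h v = ((reductionChar θ₁ h₁ a * reductionChar θ₂ h₂ d * omega p L d ^ n *
        (omega p L d / omega p L a) ^ i : (resField p L)ˣ) : resField p L) • v) :
    IsSubquotient σ (baseChangeRep (resField p L)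
      (latticeRep (T.ρ.tprod (symRepK p L n)) M hM)) := by
  classical
  obtain ⟨ϖ, hϖ, hϖ0, hden⟩ := exists_uniformizer p L
  -- Modulo the maximal ideal the characters depend only on the diagonal modulo `p`, so the reduced
  -- character of `J p c` extends to `J p 1`.
  let E : GL (Fin 2) ℤ_[p] → resField p L := fun g =>
    if hg : g ∈ J p 1 then ((reductionChar θ₁ h₁ (isUnit_diag_of_mem_J_one hg).1.unit *
      reductionChar θ₂ h₂ (isUnit_diag_of_mem_J_one hg).2.unit *
      omega p L (isUnit_diag_of_mem_J_one hg).2.unit ^ n : (resField p L)ˣ) : resField p L) else 0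
  have hEval : ∀ g ∈ J p 1, ∀ a d : ℤ_[p]ˣ, (p : ℤ_[p]) ∣ a - g.val 0 0 →
      (p : ℤ_[p]) ∣ d - g.val 1 1 → E g = ((reductionChar θ₁ h₁ a * reductionChar θ₂ h₂ d *
        omega p L d ^ n : (resField p L)ˣ) : resField p L) := by
    intro g hg a d ha hd
    have h3 : reductionChar θ₁ h₁ (isUnit_diag_of_mem_J_one hg).1.unit = reductionChar θ₁ h₁ a :=
      (reductionChar_congr h₁ ha).symm
    have h4 : reductionChar θ₂ h₂ (isUnit_diag_of_mem_J_one hg).2.unit = reductionChar θ₂ h₂ d :=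
      (reductionChar_congr h₂ hd).symm
    have h5 : omega p L (isUnit_diag_of_mem_J_one hg).2.unit = omega p L d := by
      refine Units.ext (sub_eq_zero.1 ?_).symm
      rw [val_omega, val_omega, ← map_sub, ← map_sub]
      exact (ringHom_eq_zero_iff ((residue (ringOfInt p L)).comp
        (algebraMap ℤ_[p] (ringOfInt p L))) _).2 hd
    simp only [E]
    rw [dif_pos hg, h3, h4, h5]
  have hEval' : ∀ g ∈ J p 1, ∀ a d : ℤ_[p]ˣ, (a : ℤ_[p]) = g.val 0 0 →
      (d : ℤ_[p]) = g.val 1 1 → E g = ((reductionChar θ₁ h₁ a * reductionChar θ₂ h₂ d *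
        omega p L d ^ n : (resField p L)ˣ) : resField p L) := by
    intro g hg a d ha hd
    refine hEval g hg a d ?_ ?_
    · rw [ha, sub_self]; exact dvd_zero _
    · rw [hd, sub_self]; exact dvd_zero _
  have hP : (X 1 ^ n : MvPolynomial (Fin 2) L) ∈ SymPow L n := isHomogeneous_X_pow _ _
  have hPred : IsRed (A := ringOfInt p L) (X 1 ^ n : MvPolynomial (Fin 2) L) (X 1 ^ n) :=
    ⟨X 1 ^ n, by simp, by simp⟩
  have hred : ∀ g, IsRed (tensorEval ev n (T.ρ.tprod (symRepK p L n) g (x ⊗ₜ ⟨_, hP⟩)))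
      (residue _ (integralTypeChar h₁ h₂ c hc1 g) • substGL _
      (Matrix.GeneralLinearGroup.map ((residue (ringOfInt p L)).comp
        (algebraMap ℤ_[p] (ringOfInt p L))) g) (X 1 ^ n)) := by
    intro g
    have h3 : tensorEval ev n (T.ρ.tprod (symRepK p L n) g (x ⊗ₜ ⟨_, hP⟩)) =
        algebraMap (ringOfInt p L) L (integralTypeChar h₁ h₂ c hc1 g) •
        substGL L (Matrix.GeneralLinearGroup.map (algebraMap ℤ_[p] L) g) (X 1 ^ n) := by
      rw [Representation.tprod_apply, TensorProduct.map_tmul, tensorEval_tmul, hx]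
      rfl
    rw [h3]
    exact (hPred.substGL g).smul _
  refine isSubquotient_of_slope (c := c) (E := E) (n := n)
    (χ := integralTypeChar h₁ h₂ c hc1) hϖ hϖ0 M hlat.fg
    (exists_pow_smul_mem hden hlat.span_eq_top) hM σ hirr hc
    (fun h hh z => tensorEval_apply ev n T.ρ (hev h hh) z) ?_ ?_ ?_ ?_ hi v hv0 ?_
    (x ⊗ₜ ⟨_, hP⟩) (fun g => ⟨_, hred g⟩) ?_ ?_
  · intro h hh
    have hh1 := J_le_J hc1 hh
    obtain ⟨⟨a, ha⟩, ⟨d, hd⟩⟩ := isUnit_diag_of_mem_J_one hh1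
    rw [hEval' h hh1 a d ha hd, residue_integralTypeChar h₁ h₂ hc1 hh ha hd, ← hd, ← val_omega]
    simp
  · intro g hg h hh
    obtain ⟨⟨a, ha⟩, ⟨d, hd⟩⟩ := isUnit_diag_of_mem_J_one hg
    obtain ⟨⟨a', ha'⟩, ⟨d', hd'⟩⟩ := isUnit_diag_of_mem_J_one hh
    obtain ⟨y, hy⟩ := dvd_of_mem_J_one hg
    obtain ⟨y', hy'⟩ := dvd_of_mem_J_one hh
    rw [hEval' g hg a d ha hd, hEval' h hh a' d' ha' hd',
      hEval (g * h) (mul_mem hg hh) (a * a') (d * d'), ← Units.val_mul]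
    · congr 1
      rw [map_mul, map_mul, map_mul, mul_pow]
      simp only [mul_assoc, mul_comm, mul_left_comm]
    · refine ⟨-(g.val 0 1 * y'), ?_⟩
      rw [Units.val_mul, Units.val_mul, Matrix.mul_apply, Fin.sum_univ_two, hy', ha, ha']
      ring
    · refine ⟨-(y * h.val 0 1), ?_⟩
      rw [Units.val_mul, Units.val_mul, Matrix.mul_apply, Fin.sum_univ_two, hy, hd, hd']
      ring
  · intro g hg
    simp only [E]
    rw [dif_pos hg]
    exact Units.ne_zero _
  · intro y
    rw [hEval' _ (lowerP_mem_J y) 1 1 (by simp [lowerP]) (by simp [lowerP])]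
    simp
  · intro h hh
    obtain ⟨⟨a, ha⟩, ⟨d, hd⟩⟩ := isUnit_diag_of_mem_J_one hh
    rw [hv h hh a d ha hd, hEval' h hh a d ha hd, ← ha, ← hd, ← val_omega, ← val_omega]
    simp
  · have h3 := hred 1
    rw [map_one, Module.End.one_apply] at h3
    rw [topCoeff, h3.redVal_coeff, integralTypeChar_one, one_smul, map_one, substGL_one,
      AlgHom.id_apply, coeff_X_pow, if_pos rfl]
  · intro g hg
    rw [topCoeff, (hred g).redVal_coeff, integralTypeChar, dif_neg hg, map_zero, zero_smul,
      coeff_zero]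

include hlat hirr in
theorem isSubquotient_of_det {θ : ℤ_[p]ˣ →* Lˣ} (h₁ : IsSmoothChar θ) (h₂ : IsSmoothChar θ)
    (ev : T.V →ₗ[L] L) (x : T.V)
    (hev : ∀ g y, ev (T.ρ g y) = algebraMap (ringOfInt p L) L
        (integralChar θ h₁ (Matrix.GeneralLinearGroup.det g)) * ev y) (hx : ev x = 1)
    {j e : ℕ} (he : e ≠ 0) (hn : n = (p + 1) * j + (e + (p - 1))) (v : W) (hv0 : v ≠ 0)
    (hv : ∀ h ∈ J p 1, ∀ a d : ℤ_[p]ˣ, (a : ℤ_[p]) = h.val 0 0 → (d : ℤ_[p]) = h.val 1 1 →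
      σ h v = ((reductionChar θ h₁ a * reductionChar θ h₂ d *
        (omega p L a ^ j * omega p L d ^ (n - j)) : (resField p L)ˣ) : resField p L) • v) :
    IsSubquotient σ (baseChangeRep (resField p L)
      (latticeRep (T.ρ.tprod (symRepK p L n)) M hM)) := by
  obtain ⟨ϖ, hϖ, hϖ0, hden⟩ := exists_uniformizer p L
  have hp := (Fact.out : p.Prime).two_le
  have hP : dickson L p ^ j * linePoly L p e ∈ SymPow L n := by
    rw [hn]
    exact isHomogeneous_dickson_pow_mul_linePoly L p j e
  have hPred : IsRed (A := ringOfInt p L) (dickson L p ^ j * linePoly L p e)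
      (dickson (resField p L) p ^ j * linePoly (resField p L) p e) :=
    ⟨_, map_dickson_pow_mul_linePoly _ p j e, map_dickson_pow_mul_linePoly _ p j e⟩
  set r := (residue (ringOfInt p L)).comp (algebraMap ℤ_[p] (ringOfInt p L))
  have hsub : ∀ g : GL (Fin 2) ℤ_[p], substGL (resField p L) (Matrix.GeneralLinearGroup.map r g)
      (dickson (resField p L) p ^ j * linePoly (resField p L) p e) =
      C (r (Matrix.GeneralLinearGroup.det g : ℤ_[p]ˣ) ^ j) * (dickson (resField p L) p ^ j *
        substGL _ (Matrix.GeneralLinearGroup.map r g) (linePoly (resField p L) p e)) := by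
    intro g
    rw [map_mul, map_pow, substGL_dickson, mul_pow, C_pow, mul_assoc]
  have hcoeff : ∀ g : GL (Fin 2) ℤ_[p], coeff (biExp j (n - j)) (dickson (resField p L) p ^ j *
      substGL _ (Matrix.GeneralLinearGroup.map r g) (linePoly (resField p L) p e)) =
      (-1) ^ j * (r (g.val 1 1) ^ e * (r (g.val 1 1) ^ (p - 1) - r (g.val 1 0) ^ (p - 1))) := by
    intro g
    refine coeff_dickson_pow_mul_substGL r g j e (n - j) ?_
    rw [hn, add_mul, one_mul]
    omega
  refine isSubquotient_of_coeff hϖ hϖ0 _ M hlat.fg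
    (exists_pow_smul_mem hden hlat.span_eq_top) hM σ hirr (tensorEval ev n)
    (fun g => integralChar θ h₁ (Matrix.GeneralLinearGroup.det g))
    (fun h _ z => tensorEval_apply ev n T.ρ (hev h) z)
    j (n - j) v hv0 ?_ (x ⊗ₜ ⟨_, hP⟩)
    (fun g => residue _ (integralChar θ h₁ (Matrix.GeneralLinearGroup.det g)) • substGL _
      (Matrix.GeneralLinearGroup.map r g)
      (dickson (resField p L) p ^ j * linePoly (resField p L) p e)) ?_ ?_ ?_ ?_
  · intro h hh
    obtain ⟨⟨a, ha⟩, ⟨d, hd⟩⟩ := isUnit_diag_of_mem_J_one hh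
    rw [hv h hh a d ha hd, ← val_reductionChar, reductionChar_congr h₁ (det_sub_dvd hh ha hd),
      ← ha, ← hd, ← val_omega, ← val_omega]
    simp
  · intro g
    have h3 : tensorEval ev n (T.ρ.tprod (symRepK p L n) g (x ⊗ₜ ⟨_, hP⟩)) =
        algebraMap (ringOfInt p L) L (integralChar θ h₁ (Matrix.GeneralLinearGroup.det g)) •
        substGL L (Matrix.GeneralLinearGroup.map (algebraMap ℤ_[p] L) g)
          (dickson L p ^ j * linePoly L p e) := by
      rw [Representation.tprod_apply, TensorProduct.map_tmul, tensorEval_tmul, hev, hx, mul_one]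
      rfl
    rw [h3]
    exact (hPred.substGL g).smul _
  · intro g
    have h4 : (X 0 : MvPolynomial (Fin 2) (resField p L)) ∣ dickson (resField p L) p :=
      dvd_sub ((dvd_pow_self _ (by omega)).mul_right _) (dvd_mul_right _ _)
    rw [hsub, smul_eq_C_mul]
    exact (((pow_dvd_pow_of_dvd h4 j).mul_right _).mul_left _).mul_left _
  · have h3 : r ((1 : GL (Fin 2) ℤ_[p]).val 1 1) = 1 := by simp
    have h4 : r ((1 : GL (Fin 2) ℤ_[p]).val 1 0) = 0 := by simp
    rw [coeff_smul, hsub, coeff_C_mul, hcoeff, h3, h4, zero_pow (by omega), map_one, map_one,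
      Units.val_one, map_one]
    simp
  · intro g hg
    rw [coeff_smul, hsub, coeff_C_mul, hcoeff]
    have h5 : ∀ y : ℤ_[p], ¬ (p : ℤ_[p]) ∣ y → r y ^ (p - 1) = 1 := by
      intro y hy
      have h6 : r y ≠ 0 := fun h => hy ((ringHom_eq_zero_iff r y).1 h)
      have h7 := ringHom_pow_char r y
      refine mul_right_cancel₀ h6 ?_
      rw [← pow_succ, Nat.sub_add_cancel (by omega), h7, one_mul]
    have h8 : r (g.val 1 0) ^ (p - 1) = 1 := h5 _ fun h => hg (by
      change (p : ℤ_[p]) ^ 1 ∣ g.val 1 0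
      rwa [pow_one])
    rw [h8]
    -- Outside `J p 1` the lower left entry is a unit. If `d` reduces to `0`, the factor `d^e`
    -- vanishes, which is why `e ≠ 0` is needed; otherwise both `(p-1)`-st powers are `1`.
    by_cases h9 : (p : ℤ_[p]) ∣ g.val 1 1
    · rw [(ringHom_eq_zero_iff r _).2 h9, zero_pow he]
      simp
    · rw [h5 _ h9]
      simp

end Cases

end PadicTypes

end

/-! ### Assembly of the cases. -/

theorem mainTheorem10 (p : ℕ) [Fact p.Prime] (hp : 2 < p)
    (L : Type*) [Field L] [Algebra ℚ_[p] L] [FiniteDimensional ℚ_[p] L]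
    [Algebra ℤ_[p] L] [IsScalarTower ℤ_[p] ℚ_[p] L]
    (θ₁ θ₂ : ℤ_[p]ˣ →* Lˣ) (h₁ : IsSmoothChar θ₁) (h₂ : IsSmoothChar θ₂)
    (k : ℕ) (hk : 2 ≤ k)
    (M : Submodule (ringOfInt p L) ((tau θ₁ θ₂ h₁ h₂).V ⊗[L] SymPow L (k - 2)))
    (hlat : M.IsLattice L)
    (hM : IsStable ((tau θ₁ θ₂ h₁ h₂).ρ.tprod (symRepK p L (k - 2))) M)
    (ha : θ₁ = θ₂ → p ^ 2 + 1 ≤ k)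
    (hb : θ₁ ≠ θ₂ → TrivialOn (θ₁ / θ₂) 1 → p ≤ k)
    (W : Type*) [AddCommGroup W] [Module (resField p L) W]
    (σ : Representation (resField p L) (GL (Fin 2) ℤ_[p]) W)
    (hirr : σ.IsIrreducible) (hsm : IsSmoothRep σ)
    (hcent : HasCentralChar σ
      (reductionChar θ₁ h₁ * reductionChar θ₂ h₂ * omega p L ^ (k - 2))) :
    IsSubquotient σ (baseChangeRep (resField p L)
      (latticeRep ((tau θ₁ θ₂ h₁ h₂).ρ.tprod (symRepK p L (k - 2))) M hM)) := by
  obtain ⟨j, hj, v, hv0, hv⟩ := exists_iwahori_eigenvector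
    ((IsLocalRing.residue (ringOfInt p L)).comp (algebraMap ℤ_[p] (ringOfInt p L))) hirr hsm hcent
    (reductionChar θ₁ h₁) (fun u hu => reductionChar_eq_one h₁ hu)
  have hv' : j ≤ k - 2 → ∀ h ∈ J p 1, ∀ a d : ℤ_[p]ˣ, (a : ℤ_[p]) = h.val 0 0 →
      (d : ℤ_[p]) = h.val 1 1 → σ h v = ((reductionChar θ₁ h₁ a * reductionChar θ₂ h₂ d *
        (omega p L a ^ j * omega p L d ^ (k - 2 - j)) : (resField p L)ˣ) : resField p L) • v := by
    intro hjk h hh a d ha hd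
    rw [hv h hh a d ha hd]
    congr 2
    change reductionChar θ₁ h₁ (a * d⁻¹) * omega p L (a * d⁻¹) ^ j *
      (reductionChar θ₁ h₁ d * reductionChar θ₂ h₂ d * omega p L d ^ (k - 2)) = _
    have h3 : omega p L d ^ (k - 2) = omega p L d ^ (k - 2 - j) * omega p L d ^ j := by
      rw [← pow_add, Nat.sub_add_cancel hjk]
    rw [h3, map_mul, map_mul, map_inv, map_inv, mul_pow, inv_pow]
    generalize omega p L d ^ j = y
    generalize reductionChar θ₁ h₁ d = z
    refine Units.ext ?_
    push_cast
    field_simp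
  by_cases hθ : θ₁ = θ₂
  · subst hθ
    have hk' := ha rfl
    obtain ⟨ev, x, hev, hx⟩ := exists_functional_tau_self h₁ h₂
    -- The extreme case `j = p - 2` requires `p² - 2 ≤ k - 2`. The surplus over `(p+1)j + (p-1)` is
    -- the exponent `e ≥ 1` used below.
    have hle : (p + 1) * j + p ≤ k - 2 := by
      obtain ⟨q, rfl⟩ : ∃ q, p = q + 2 := ⟨p - 2, by omega⟩
      have h3 : j ≤ q := by omega
      have h4 : (q + 2 + 1) * j ≤ (q + 2 + 1) * q := Nat.mul_le_mul_left _ h3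
      have h5 : (q + 2) ^ 2 + 1 = (q + 2 + 1) * q + (q + 5) := by ring
      omega
    have hjle : j ≤ k - 2 := by nlinarith
    refine isSubquotient_of_det _ M hlat hM σ hirr h₁ h₂ ev x hev hx
      (e := k - 2 - ((p + 1) * j) - (p - 1)) (by omega) (by omega) v hv0 (hv' hjle)
  · obtain ⟨hc1, hctriv⟩ := conductor_spec (h₁.div h₂)
    generalize hcc : conductor (θ₁ / θ₂) = c at hc1 hctriv
    obtain ⟨ev, x, hev, hx⟩ := exists_functional_tau_of_ne h₁ h₂ hθ hcc hc1
    rcases hc1.eq_or_lt with rfl | hc2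
    · have hk' := hb hθ hctriv
      exact isSubquotient_of_conductor_one _ M hlat hM σ hirr h₁ h₂ ev x hev hx (by omega) v hv0
        (hv' (by omega))
    · refine isSubquotient_of_two_le_conductor _ M hlat hM σ hirr h₁ h₂ hc2 hc1 ev x hev hx
        -- Since `ω^(p-1) = 1`, the twist by `(d/a)^(p-1-j)` equals the twist by `(a/d)^j` in the
        -- character of `v`.
        (i := p - 1 - j) (Nat.sub_le _ _) v hv0 fun h hh a d ha hd => ?_
      rw [hv h hh a d ha hd]
      congr 2
      change reductionChar θ₁ h₁ (a * d⁻¹) * omega p L (a * d⁻¹) ^ j *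
        (reductionChar θ₁ h₁ d * reductionChar θ₂ h₂ d * omega p L d ^ (k - 2)) = _
      have h3 : (omega p L d / omega p L a) ^ (p - 1 - j) = omega p L (a * d⁻¹) ^ j := by
        rw [← map_div, ← map_pow, ← map_pow, ← mul_inv_eq_one, ← map_inv, ← map_mul]
        have h4 : (d / a) ^ (p - 1 - j) * ((a * d⁻¹) ^ j)⁻¹ = (d / a) ^ (p - 1) := by
          rw [← inv_pow, mul_inv_rev, inv_inv, ← div_eq_mul_inv, ← pow_add,
            Nat.sub_add_cancel hj.le]
        rw [h4, map_pow, omega_pow]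
      rw [h3, map_mul (reductionChar θ₁ h₁), map_inv]
      generalize omega p L (a * d⁻¹) ^ j = y
      generalize reductionChar θ₁ h₁ d = z
      refine Units.ext ?_
      push_cast
      field_simp
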